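/- Let $\lambda>0$, let $w=p/q\in(0,1)$ with $p,q$ relatively prime positive integers, and let $k\ge 2$ be an integer. Let $\Pi$ be a homogeneous Poisson point process of intensity $\lambda$ on $(0,1]$, regarded as a random finite subset of $(0,1]$. For a finite multiset $F$ of points of $(0,1]$ put $$S_w(F)=\max_{0\le t\le 1-w}|F\cap(t,t+w]|$$ (points counted with multiplicity), and let $\alpha=\mathbb{P}(S_w(\Pi)\ge k)$. For $n=mq$ $(m=1,2,\dots)$ let $I^n_1,\dots,I^n_n$ be i.i.d. with $\mathbb{P}(I^n_i=0)=e^{-\lambda/n}$ and $\mathbb{P}(I^n_i=1)=1-e^{-\lambda/n}$, and let $$\alpha_n=\mathbb{P}\Big(\max_{1\le i\le n-nw+1}\ \sum_{r=i}^{i+nw-1}I^n_r\ \ge k\Big).$$ Define $$\nu(\Pi)=\sum_{Q\in\Pi,\ Q<1-w}\mathbf 1\Big\{S_w(\Pi)<k,\ |\Pi\cap(Q,Q+w]|=k-2,\ |\Pi\cap(t,t+w]|\le k-2\text{ for all }t\text{ with }Q\le t\le Q+w\Big\},$$ $$\tilde\nu(\Pi)=\sum_{Q\in\Pi}\mathbf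 1\Big\{S_w(\Pi)<k,\ S_w(\Pi\cup\{Q\})=k\Big\},$$ where $\Pi\cup\{Q\}$ is the multiset in which $Q$ has multiplicity $2$. Theorem 2.1. The random variable $\nu(\Pi)+\tilde\nu(\Pi)$ is integrable and, as $m\to\infty$ with $n=mq$, $$\lim_{n\to\infty}n(\alpha-\alpha_n)=\frac{\lambda}{2}\,\mathbb{E}\big[\nu(\Pi)+\tilde\nu(\Pi)\big].$$ -/

import Mathlib

open MeasureTheory ProbabilityTheory Set Filter Topology

namespace ScanStatistic

noncomputable section

/-- The number of points, counted with multiplicity, that the configuration `s` has in `B`. -/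
def count (s : Multiset ℝ) (B : Set ℝ) : ℕ :=
  open Classical in s.countP (fun x => x ∈ B)

/-- The continuous scan statistic `S_w(s) = max_{0 ≤ t ≤ 1 - w} |s ∩ (t, t + w]|` of a finite
configuration `s` (a multiset of points). See `isGreatest_scan`: the supremum is a maximum. -/
def scan (w : ℝ) (s : Multiset ℝ) : ℕ :=
  sSup ((fun t : ℝ => count s (Ioc t (t + w))) '' Icc 0 (1 - w))

theorem count_le_card (s : Multiset ℝ) (B : Set ℝ) : count s B ≤ Multiset.card s := by
  classical
  unfold count
  exact Multiset.countP_le_card _ _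

theorem isGreatest_scan {w : ℝ} (hw : w ≤ 1) (s : Multiset ℝ) :
    IsGreatest ((fun t : ℝ => count s (Ioc t (t + w))) '' Icc 0 (1 - w)) (scan w s) := by
  have hne : ((fun t : ℝ => count s (Ioc t (t + w))) '' Icc 0 (1 - w)).Nonempty :=
    ⟨_, 0, ⟨le_rfl, by linarith⟩, rfl⟩
  have hbdd : BddAbove ((fun t : ℝ => count s (Ioc t (t + w))) '' Icc 0 (1 - w)) := by
    refine ⟨Multiset.card s, ?_⟩
    rintro _ ⟨t, -, rfl⟩
    exact count_le_card _ _
  exact ⟨Nat.sSup_mem hne hbdd, fun _ h => le_csSup hbdd h⟩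

/-- `X` is a homogeneous Poisson point process of intensity `lam` on `(0, 1]`, viewed as a random
finite subset of `(0, 1]`: the number of points in a Borel set `B ⊆ (0, 1]` is a Poisson random
variable with mean `lam` times the length of `B`, and the numbers of points in finitely many
pairwise disjoint Borel sets are independent. -/
structure IsPoissonProcess {Ω : Type*} [MeasurableSpace Ω] (P : Measure Ω) (lam : ℝ)
    (X : Ω → Finset ℝ) : Prop where
  mem_Ioc : ∀ ω, ∀ x ∈ X ω, x ∈ Ioc (0 : ℝ) 1
  measurable_count : ∀ B : Set ℝ, MeasurableSet B → Measurable fun ω => count (X ω).val B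
  map_count : ∀ B : Set ℝ, MeasurableSet B → B ⊆ Ioc (0 : ℝ) 1 →
    P.map (fun ω => count (X ω).val B) = poissonMeasure (lam * volume.real B).toNNReal
  indep_count : ∀ (j : ℕ) (B : Fin j → Set ℝ), (∀ i, MeasurableSet (B i)) →
    Pairwise (fun a b => Disjoint (B a) (B b)) →
    iIndepFun (fun i ω => count (X ω).val (B i)) P

/-- `I 0, …, I (n - 1)` are i.i.d. random variables with values in `{0, 1}` almost surely,
`P (I i = 0) = exp (-lam / n)` and `P (I i = 1) = 1 - exp (-lam / n)`. -/
structure IsBernoulliCells {Ω : Type*} [MeasurableSpace Ω] (P : Measure Ω) (lam : ℝ) (n : ℕ)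
    (I : Fin n → Ω → ℕ) : Prop where
  measurable : ∀ i, Measurable (I i)
  indep : iIndepFun I P
  prob_zero : ∀ i, P.real {ω | I i ω = 0} = Real.exp (-lam / n)
  prob_one : ∀ i, P.real {ω | I i ω = 1} = 1 - Real.exp (-lam / n)

/-- The discrete scan statistic: the maximum, over all windows of `L` consecutive indices within
`{0, …, n - 1}`, of the sum of the `h r` with `r` in the window (used with `L ≤ n`). -/
def discreteScan (n L : ℕ) (h : Fin n → ℕ) : ℕ :=
  (Finset.range (n - L + 1)).sup fun i =>
    ∑ r ∈ Finset.univ.filter (fun r : Fin n => i ≤ (r : ℕ) ∧ (r : ℕ) < i + L), h r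

/-- The functional `ν`: the number of points `x < 1 - w` of the configuration `s` with `S_w < k`,
`|s ∩ (x, x + w]| = k - 2`, and `|s ∩ (t, t + w]| ≤ k - 2` for all `t` with `x ≤ t ≤ x + w`. -/
def nu (k : ℕ) (w : ℝ) (s : Finset ℝ) : ℕ :=
  open Classical in
  (s.filter fun x => x < 1 - w ∧ scan w s.val < k ∧
    count s.val (Ioc x (x + w)) + 2 = k ∧
    ∀ t : ℝ, x ≤ t → t ≤ x + w → count s.val (Ioc t (t + w)) + 2 ≤ k).card

/-- The functional `ν̃`: the number of points `x` of the configuration `s` with `S_w < k` such that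
the scan statistic becomes `k` when the multiplicity of `x` is raised to `2`. -/
def nuTilde (k : ℕ) (w : ℝ) (s : Finset ℝ) : ℕ :=
  open Classical in
  (s.filter fun x => scan w s.val < k ∧ scan w (x ::ₘ s.val) = k).card

end

end ScanStatistic

/-!
The proof never conditions on the positions of the points. It compares the grid of side length
`1 / n` with the one of side length `1 / (2 * n)`, both carried by the same Poisson process. Write
`α n` for the probability that some grid window contains at least `k` occupied cells of side length
`1 / n`.

Let `g` be the occupation indicators of the `2 * n` fine cells; they are independent, and each is
`1` with the same probability `ρ = 1 - exp (-lam / (2 * n))`. The indicators of the `n` coarse cells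
are `h = coarsen g`, and they have the law of the Bernoulli cells
(`IsBernoulliCells.measureReal_discreteScan`). Hence `α (2n) - α n` is the probability of
`ScanJump`, the event that the fine scan statistic is at least `k` and the coarse one is not.

Call it a coincidence if two fine cells are occupied whose coarse cells are equal or have the
distance `L = n w`. With no coincidence there is no jump. With a single one, there is a jump exactly
if it is a gain, and there are two kinds of gains: either the later half of cell `i` and the earlier
half of cell `i + L` are occupied, with `k - 2` occupied cells in between (`PairGain`), so that a
fine window catches both ends where a coarse window cannot; or both halves of cell `i` are occupied,
in a place where a second point lifts the scan statistic to `k` (`DoubleGain`). Two coincidences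
have probability `O(1 / n ^ 2)` (`integral_card_offDiag_le`), so up to this error the probability of
a jump is the expected number of gains (`abs_measureReal_scanJump_sub_le`). By independence the
latter equals `ρ / 2` times the expectation of discrete versions of `ν` and `ν̃`, up to a factor
tending to `1` (`integral_gainCount`).

For a fixed configuration in general position the discrete `ν`, `ν̃` and scan statistic are
eventually equal to the continuous ones (`eventually_pairCount`, `eventually_doubleCount`,
`eventually_windowScan_occ`). Since `ν` and `ν̃` are at most the number of points, dominated
convergence gives `n (α (2n) - α n) → lam / 4 * E[ν + ν̃]`, and `α n → α`. Adding up the differences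
along `n, 2n, 4n, …` doubles the constant (`tendsto_mul_sub_of_doubling`).
-/

namespace ScanStatistic

/-! ### Refining a `0`-`1` configuration: deterministic part -/

/-- The discrete scan statistic of a sequence indexed by `ℕ`: the maximum over `0 ≤ i ≤ n - L` of
the sum of `h` over the window `{i, …, i + L - 1}`. It is meant for `L ≤ n`. -/
def windowScan (n L : ℕ) (h : ℕ → ℕ) : ℕ :=
  (Finset.range (n - L + 1)).sup fun i => ∑ r ∈ Finset.Ico i (i + L), h r

theorem windowScan_lt_iff {n L k : ℕ} (hk : 0 < k) {h : ℕ → ℕ} :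
    windowScan n L h < k ↔ ∀ i ≤ n - L, ∑ r ∈ Finset.Ico i (i + L), h r < k := by
  simp [windowScan, Finset.sup_lt_iff hk]

theorem le_windowScan_iff {n L k : ℕ} (hk : 0 < k) {h : ℕ → ℕ} :
    k ≤ windowScan n L h ↔ ∃ i ≤ n - L, k ≤ ∑ r ∈ Finset.Ico i (i + L), h r := by
  rw [← not_lt, windowScan_lt_iff hk]
  push Not
  rfl

theorem windowScan_dependsOn {n L : ℕ} (hL : L ≤ n) :
    DependsOn (windowScan n L) (Finset.range n : Set ℕ) := by
  intro x y hxy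
  refine Finset.sup_congr rfl fun i hi => Finset.sum_congr rfl fun r hr => hxy r ?_
  simp at *
  omega

theorem le_windowScan_dependsOn {n L : ℕ} (hL : L ≤ n) (k : ℕ) :
    DependsOn (fun h => k ≤ windowScan n L h) (Finset.range n : Set ℕ) := by
  intro x y hxy
  simp only [windowScan_dependsOn hL hxy]

theorem discreteScan_eq_windowScan {n L : ℕ} (hL : L ≤ n) (h : ℕ → ℕ) :
    discreteScan n L (fun r => h r) = windowScan n L h := by
  refine Finset.sup_congr rfl fun i hi => ?_
  simp only [Finset.mem_range] at hi
  refine Finset.sum_bij (fun r _ => (r : ℕ)) ?_ ?_ ?_ ?_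
  · intro a ha; simpa using ha
  · intro a _ b _ hab; exact Fin.ext hab
  · intro b hb
    simp only [Finset.mem_Ico] at hb
    exact ⟨⟨b, by omega⟩, by simpa using hb, rfl⟩
  · intro a _; rfl

/-- Every coarse cell `i` consists of the fine cells `2 * i` and `2 * i + 1`, and it is occupied as
soon as one of the two is. -/
def coarsen (g : ℕ → ℕ) (i : ℕ) : ℕ := max (g (2 * i)) (g (2 * i + 1))

/-- The condition on the coarse cells other than `i` and `i + L` under which occupying both of
these brings the closed window from `i` to `i + L` to exactly `k` occupied cells, while the scan
statistic stays below `k`. -/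
def PairCritical (n L k i : ℕ) (h : ℕ → ℕ) : Prop :=
  ∑ r ∈ Finset.Ico (i + 1) (i + L), h r + 2 = k ∧
    windowScan n L (Function.update (Function.update h i 1) (i + L) 1) < k

/-- The condition on the coarse cells other than `i` under which the scan statistic is below `k`
for one point in cell `i` and at least `k` for two points there. -/
def DoubleCritical (n L k i : ℕ) (h : ℕ → ℕ) : Prop :=
  windowScan n L (Function.update h i 1) < k ∧ k ≤ windowScan n L (Function.update h i 2)

/-- The fine configuration occupies the later half of cell `i` and the earlier half of cell
`i + L`, so that a fine window catches both, in a critical surrounding. -/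
def PairGain (n L k i : ℕ) (g : ℕ → ℕ) : Prop :=
  (g (2 * i) = 0 ∧ g (2 * i + 1) = 1 ∧ g (2 * (i + L)) = 1 ∧ g (2 * (i + L) + 1) = 0) ∧
    PairCritical n L k i (coarsen g)

/-- The fine configuration occupies both halves of cell `i`, in a critical surrounding. -/
def DoubleGain (n L k i : ℕ) (g : ℕ → ℕ) : Prop :=
  (g (2 * i) = 1 ∧ g (2 * i + 1) = 1) ∧ DoubleCritical n L k i (coarsen g)

open Classical in
/-- The number of ways in which passing to the fine grid can raise the scan statistic to `k`. -/
noncomputable def gainCount (n L k : ℕ) (g : ℕ → ℕ) : ℕ :=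
  ((Finset.range (n - L)).filter fun i => PairGain n L k i g).card +
    ((Finset.range n).filter fun i => DoubleGain n L k i g).card

/-- The scan statistic reaches `k` on the fine grid, but not on the coarse one. -/
def ScanJump (n L k : ℕ) (g : ℕ → ℕ) : Prop :=
  k ≤ windowScan (2 * n) (2 * L) g ∧ windowScan n L (coarsen g) < k

/-- Pairs of fine cells, in increasing order, whose coarse cells agree or lie at distance `L`. -/
def coincidencePairs (n L : ℕ) : Finset (ℕ × ℕ) :=
  (Finset.range (2 * n) ×ˢ Finset.range (2 * n)).filter fun e =>
    e.1 < e.2 ∧ (e.2 / 2 = e.1 / 2 ∨ e.2 / 2 = e.1 / 2 + L)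

/-- The pairs of `coincidencePairs` both of whose cells are occupied. -/
def coincidences (n L : ℕ) (g : ℕ → ℕ) : Finset (ℕ × ℕ) :=
  (coincidencePairs n L).filter fun e => g e.1 = 1 ∧ g e.2 = 1

theorem sum_fine_window (g : ℕ → ℕ) (a b : ℕ) :
    ∑ j ∈ Finset.Ico (2 * a) (2 * b), g j =
      ∑ r ∈ Finset.Ico a b, (g (2 * r) + g (2 * r + 1)) := by
  rcases le_total b a with hba | hab
  · rw [Finset.Ico_eq_empty_of_le hba, Finset.Ico_eq_empty_of_le (by omega)]; simp
  induction b, hab using Nat.le_induction with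
  | base => simp
  | succ b hb ih =>
    rw [Finset.sum_Ico_succ_top hb, ← ih, show 2 * (b + 1) = 2 * b + 1 + 1 by ring,
      Finset.sum_Ico_succ_top (by omega), Finset.sum_Ico_succ_top (by omega)]
    ring

theorem coarsen_le_add (g : ℕ → ℕ) (r : ℕ) : coarsen g r ≤ g (2 * r) + g (2 * r + 1) := by
  unfold coarsen; omega

theorem windowScan_coarsen_le {n L : ℕ} (g : ℕ → ℕ) :
    windowScan n L (coarsen g) ≤ windowScan (2 * n) (2 * L) g := by
  refine Finset.sup_le fun i hi => ?_
  simp only [Finset.mem_range] at hi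
  calc _ ≤ ∑ r ∈ Finset.Ico i (i + L), (g (2 * r) + g (2 * r + 1)) :=
        Finset.sum_le_sum fun r _ => coarsen_le_add g r
    _ = ∑ j ∈ Finset.Ico (2 * i) (2 * i + 2 * L), g j := by
        rw [← sum_fine_window, show 2 * (i + L) = 2 * i + 2 * L by ring]
    _ ≤ _ := Finset.le_sup (f := fun i => ∑ r ∈ Finset.Ico i (i + 2 * L), g r)
        (by simp only [Finset.mem_range]; omega)

theorem update_coarsen_one {g : ℕ → ℕ} {i : ℕ} (hi : coarsen g i = 1) :
    Function.update (coarsen g) i 1 = coarsen g := by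
  rw [← hi, Function.update_eq_self]

/-- The window of `2 * L` fine cells starting at the odd cell `2 * i + 1`. -/
theorem sum_odd_window (g : ℕ → ℕ) {i L : ℕ} (hL : 1 ≤ L) :
    ∑ j ∈ Finset.Ico (2 * i + 1) (2 * i + 1 + 2 * L), g j = g (2 * i + 1) +
      ∑ r ∈ Finset.Ico (i + 1) (i + L), (g (2 * r) + g (2 * r + 1)) + g (2 * (i + L)) := by
  rw [show 2 * i + 1 + 2 * L = 2 * (i + L) + 1 by ring,
    Finset.sum_Ico_succ_top (by omega), Finset.sum_eq_sum_Ico_succ_bot (by omega),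
    show 2 * i + 1 + 1 = 2 * (i + 1) by ring, sum_fine_window]

theorem PairGain.scanJump {n L k i : ℕ} (hL : 1 ≤ L) (hk : 0 < k) (hi : i < n - L) {g : ℕ → ℕ}
    (h : PairGain n L k i g) : ScanJump n L k g := by
  obtain ⟨⟨h0, h1, h2, h3⟩, h4, h5⟩ := h
  rw [update_coarsen_one (by simp [coarsen, h0, h1]),
    update_coarsen_one (by simp [coarsen, h2, h3])] at h5
  refine ⟨(le_windowScan_iff hk).2 ⟨2 * i + 1, by omega, ?_⟩, h5⟩
  rw [sum_odd_window g hL]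
  have := Finset.sum_le_sum fun r (_ : r ∈ Finset.Ico (i + 1) (i + L)) => coarsen_le_add g r
  omega

theorem DoubleGain.scanJump {n L k i : ℕ} (hk : 0 < k) {g : ℕ → ℕ}
    (h : DoubleGain n L k i g) : ScanJump n L k g := by
  obtain ⟨⟨h0, h1⟩, h4, h5⟩ := h
  rw [update_coarsen_one (by simp [coarsen, h0, h1])] at h4
  obtain ⟨s, hs, hs'⟩ := (le_windowScan_iff hk).1 h5
  refine ⟨(le_windowScan_iff hk).2 ⟨2 * s, by omega, hs'.trans ?_⟩, h4⟩
  rw [← mul_add, sum_fine_window]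
  refine Finset.sum_le_sum fun r _ => ?_
  rcases eq_or_ne r i with rfl | hr
  · simp [h0, h1]
  · simpa [Function.update_of_ne hr] using coarsen_le_add g r

theorem gainCount_le_coincidences {n L k : ℕ} (hL : 1 ≤ L) (g : ℕ → ℕ) :
    gainCount n L k g ≤ (coincidences n L g).card := by
  classical
  unfold gainCount
  rw [← Finset.card_image_of_injective (f := fun i : ℕ => (2 * i + 1, 2 * (i + L)))
      (Finset.filter _ (Finset.range (n - L))) (fun a b h => by simp at h; omega),
    ← Finset.card_image_of_injective (f := fun i : ℕ => (2 * i, 2 * i + 1))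
      (Finset.filter _ (Finset.range n)) (fun a b h => by simp at h; omega),
    ← Finset.card_union_of_disjoint]
  · refine Finset.card_le_card ?_
    intro e he
    simp only [Finset.mem_union, Finset.mem_image, Finset.mem_filter, Finset.mem_range] at he
    simp only [coincidences, coincidencePairs, Finset.mem_filter, Finset.mem_product,
      Finset.mem_range]
    rcases he with ⟨i, ⟨hi, hg⟩, rfl⟩ | ⟨i, ⟨hi, hg⟩, rfl⟩
    · exact ⟨by dsimp only; omega, hg.1.2.1, hg.1.2.2.1⟩
    · exact ⟨by dsimp only; omega, hg.1⟩
  · rw [Finset.disjoint_left]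
    intro e he he'
    simp only [Finset.mem_image] at he he'
    obtain ⟨i, -, rfl⟩ := he
    obtain ⟨j, -, hj⟩ := he'
    simp at hj
    omega

theorem eq_of_mem_coincidences {n L : ℕ} {g : ℕ → ℕ} (hT : (coincidences n L g).card ≤ 1)
    {a b a' b' : ℕ} (hab : a < b) (hb : b < 2 * n) (h : b / 2 = a / 2 ∨ b / 2 = a / 2 + L)
    (hga : g a = 1) (hgb : g b = 1) (hab' : a' < b') (hb' : b' < 2 * n)
    (h' : b' / 2 = a' / 2 ∨ b' / 2 = a' / 2 + L) (hga' : g a' = 1) (hgb' : g b' = 1) :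
    a = a' ∧ b = b' := by
  have := Finset.card_le_one.1 hT (a, b)
    (by simp only [coincidences, coincidencePairs, Finset.mem_filter, Finset.mem_product,
          Finset.mem_range]; exact ⟨⟨⟨by omega, hb⟩, hab, h⟩, hga, hgb⟩) (a', b')
    (by simp only [coincidences, coincidencePairs, Finset.mem_filter, Finset.mem_product,
          Finset.mem_range]; exact ⟨⟨⟨by omega, hb'⟩, hab', h'⟩, hga', hgb'⟩)
  simpa using this

/-- If a fine window that is aligned with the coarse grid has `k` points, although no coarse window
has, then it contains a doubly occupied coarse cell. If this is the only coincidence, it accounts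
for the whole difference. -/
theorem exists_doubleGain {n L k s : ℕ} (hLn : L ≤ n) (hk : 0 < k) {g : ℕ → ℕ}
    (hg : ∀ j, g j ≤ 1) (hs : s ≤ n - L)
    (hsum : k ≤ ∑ r ∈ Finset.Ico s (s + L), (g (2 * r) + g (2 * r + 1)))
    (hc : windowScan n L (coarsen g) < k) (hT : (coincidences n L g).card ≤ 1) :
    ∃ i < n, DoubleGain n L k i g := by
  have hsc := (windowScan_lt_iff hk).1 hc s hs
  obtain ⟨i, hi, hlt⟩ := Finset.exists_lt_of_sum_lt (hsc.trans_le hsum)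
  have hi' := Finset.mem_Ico.1 hi
  have h0 := hg (2 * i)
  have h1 := hg (2 * i + 1)
  have hd : g (2 * i) = 1 ∧ g (2 * i + 1) = 1 := by
    unfold coarsen at hlt; omega
  refine ⟨i, by omega, hd, ?_, (le_windowScan_iff hk).2 ⟨s, hs, hsum.trans ?_⟩⟩
  · rwa [update_coarsen_one (by simp [coarsen, hd])]
  · refine Finset.sum_le_sum fun r hr => ?_
    have hr' := Finset.mem_Ico.1 hr
    rcases eq_or_ne r i with rfl | hri
    · simp [hd]
    · rw [Function.update_of_ne hri]
      by_contra hlt'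
      have h0 := hg (2 * r)
      have h1 := hg (2 * r + 1)
      have hd' : g (2 * r) = 1 ∧ g (2 * r + 1) = 1 := by
        unfold coarsen at hlt'; omega
      have := eq_of_mem_coincidences hT (a := 2 * i) (b := 2 * i + 1) (a' := 2 * r)
        (b' := 2 * r + 1) (by omega) (by omega) (by omega) hd.1 hd.2 (by omega) (by omega)
        (by omega) hd'.1 hd'.2
      omega

theorem one_le_gainCount {n L k : ℕ} (hL : 1 ≤ L) (hLn : L ≤ n) (hk : 0 < k) {g : ℕ → ℕ}
    (hg : ∀ j, g j ≤ 1) (hA : ScanJump n L k g) (hT : (coincidences n L g).card ≤ 1) :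
    1 ≤ gainCount n L k g := by
  classical
  obtain ⟨hf, hc⟩ := hA
  have of_double : (∃ i < n, DoubleGain n L k i g) → 1 ≤ gainCount n L k g := by
    rintro ⟨i, hi, hi'⟩
    refine le_add_left (Finset.card_pos.2 ⟨i, ?_⟩)
    simp [hi, hi']
  obtain ⟨j, hj, hsum⟩ := (le_windowScan_iff hk).1 hf
  obtain ⟨i, rfl | rfl⟩ : ∃ i, j = 2 * i ∨ j = 2 * i + 1 := ⟨j / 2, by omega⟩
  · rw [← mul_add, sum_fine_window] at hsum
    exact of_double (exists_doubleGain hLn hk hg (by omega) hsum hc hT)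
  rw [sum_odd_window g hL] at hsum
  have e1 := hg (2 * i + 1)
  have e2 := hg (2 * (i + L))
  by_cases h1 : g (2 * i + 1) = 0
  · refine of_double (exists_doubleGain hLn hk hg (s := i + 1) (by omega) (hsum.trans ?_) hc hT)
    rw [show i + 1 + L = i + L + 1 by ring, Finset.sum_Ico_succ_top (by omega)]
    simp only [h1]
    omega
  by_cases h2 : g (2 * (i + L)) = 0
  · refine of_double (exists_doubleGain hLn hk hg (s := i) (by omega) (hsum.trans ?_) hc hT)
    rw [Finset.sum_eq_sum_Ico_succ_bot (show i < i + L by omega)]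
    omega
  have h1' : g (2 * i + 1) = 1 := by omega
  have h2' : g (2 * (i + L)) = 1 := by omega
  -- the two end cells form the only coincidence, hence no coarse cell is doubly occupied
  have huniq := fun a b => eq_of_mem_coincidences hT (a := 2 * i + 1) (b := 2 * (i + L)) (a' := a)
    (b' := b) (by omega) (by omega) (by omega) h1' h2'
  have hnd : ∀ r < n, g (2 * r) + g (2 * r + 1) = coarsen g r := by
    intro r hr
    have h0 := hg (2 * r)
    have h1 := hg (2 * r + 1)
    by_contra hne
    have hd' : g (2 * r) = 1 ∧ g (2 * r + 1) = 1 := by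
      unfold coarsen at hne; omega
    have := huniq (2 * r) (2 * r + 1) (by omega) (by omega) (by omega) hd'.1 hd'.2
    omega
  have hmid : ∑ r ∈ Finset.Ico (i + 1) (i + L), (g (2 * r) + g (2 * r + 1)) =
      ∑ r ∈ Finset.Ico (i + 1) (i + L), coarsen g r :=
    Finset.sum_congr rfl fun r hr => hnd r (by have := Finset.mem_Ico.1 hr; omega)
  have hw := (windowScan_lt_iff hk).1 hc i (by omega)
  rw [Finset.sum_eq_sum_Ico_succ_bot (by omega)] at hw
  have hi0 := hnd i (by omega)
  have hiL := hnd (i + L) (by omega)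
  have hci : coarsen g i = 1 := by unfold coarsen at *; have := hg (2 * i); omega
  have hciL : coarsen g (i + L) = 1 := by
    unfold coarsen at *; have := hg (2 * (i + L) + 1); omega
  refine le_add_right (Finset.card_pos.2 ⟨i, ?_⟩)
  simp only [Finset.mem_filter, Finset.mem_range]
  refine ⟨by omega, ⟨by omega, h1', h2', by omega⟩, by omega, ?_⟩
  rwa [update_coarsen_one hci, update_coarsen_one hciL]

open Classical in
/-- The jump of the scan statistic equals the number of gains, up to an error that vanishes unless
there are two coincidences. -/
theorem abs_scanJump_sub_gainCount_le {n L k : ℕ} (hL : 1 ≤ L) (hLn : L ≤ n) (hk : 0 < k)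
    {g : ℕ → ℕ} (hg : ∀ j, g j ≤ 1) :
    |(if ScanJump n L k g then (1 : ℝ) else 0) - gainCount n L k g| ≤
      (coincidences n L g).offDiag.card := by
  have hZ := gainCount_le_coincidences (n := n) (k := k) hL g
  have h1 := one_le_gainCount (k := k) hL hLn hk hg
  have h2 : 1 ≤ gainCount n L k g → ScanJump n L k g := by
    intro h
    by_contra hA
    have : gainCount n L k g = 0 := by
      unfold gainCount
      rw [Finset.filter_eq_empty_iff.2, Finset.filter_eq_empty_iff.2]
      · rfl
      · exact fun i _ hi' => hA (hi'.scanJump hk)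
      · exact fun i hi hi' => hA (hi'.scanJump hL hk (Finset.mem_range.1 hi))
    omega
  rw [Finset.offDiag_card]
  generalize (coincidences n L g).card = T at *
  generalize gainCount n L k g = Z at *
  rcases Nat.lt_or_ge 1 T with hT | hT
  · have hTT : 2 * T ≤ T * T := Nat.mul_le_mul_right T hT
    have h3 : (Z : ℝ) ≤ T := by exact_mod_cast hZ
    have h4 : (T : ℝ) ≤ ((T * T - T : ℕ) : ℝ) := by exact_mod_cast (by omega)
    have h5 : (1 : ℝ) ≤ T := by exact_mod_cast hT.le
    have h6 : (0 : ℝ) ≤ Z := by positivity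
    rw [abs_le]
    split_ifs <;> constructor <;> linarith
  · by_cases hA : ScanJump n L k g
    · have := h1 hA hT
      have hZ1 : Z = 1 := by omega
      simp [hA, hZ1]
    · have hZ0 : Z = 0 := by by_contra h; exact hA (h2 (by omega))
      simp [hA, hZ0]

/-! ### Counting points in windows and cells -/

@[simp] theorem count_zero (B : Set ℝ) : count 0 B = 0 := by
  simp [count]

open Classical in
theorem count_cons (a : ℝ) (s : Multiset ℝ) (B : Set ℝ) :
    count (a ::ₘ s) B = count s B + if a ∈ B then 1 else 0 := by
  simp [count, Multiset.countP_cons]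

theorem count_mono {s : Multiset ℝ} {A B : Set ℝ} (h : ∀ x ∈ s, x ∈ A → x ∈ B) :
    count s A ≤ count s B := by
  classical
  induction s using Multiset.induction with
  | empty => simp
  | cons a s ih =>
    rw [count_cons, count_cons]
    have h1 := ih fun x hx => h x (Multiset.mem_cons_of_mem hx)
    have h2 := h a (Multiset.mem_cons_self a s)
    split_ifs <;> first | omega | exact absurd (h2 ‹_›) ‹_›

theorem count_congr {s : Multiset ℝ} {A B : Set ℝ} (h : ∀ x ∈ s, x ∈ A ↔ x ∈ B) :
    count s A = count s B :=
  le_antisymm (count_mono fun x hx => (h x hx).1) (count_mono fun x hx => (h x hx).2)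

theorem count_pos_iff {s : Multiset ℝ} {B : Set ℝ} : 0 < count s B ↔ ∃ x ∈ s, x ∈ B := by
  classical
  simp [count, Multiset.countP_pos]

theorem count_eq_zero_iff {s : Multiset ℝ} {B : Set ℝ} : count s B = 0 ↔ ∀ x ∈ s, x ∉ B := by
  rw [← not_iff_not, ← Ne, ← Nat.pos_iff_ne_zero, count_pos_iff]
  push Not
  rfl

theorem count_union {s : Multiset ℝ} {A B : Set ℝ} (h : Disjoint A B) :
    count s (A ∪ B) = count s A + count s B := by
  classical
  induction s using Multiset.induction with
  | empty => simp
  | cons a s ih =>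
    have : a ∈ A → a ∉ B := fun h1 h2 => Set.disjoint_left.1 h h1 h2
    simp only [count_cons, ih, Set.mem_union]
    by_cases h1 : a ∈ A <;> by_cases h2 : a ∈ B <;> simp_all <;> omega

theorem count_Ioc_add (s : Multiset ℝ) {a b c : ℝ} (hab : a ≤ b) (hbc : b ≤ c) :
    count s (Ioc a b) + count s (Ioc b c) = count s (Ioc a c) := by
  rw [← Ioc_union_Ioc_eq_Ioc hab hbc, count_union]
  exact Set.disjoint_left.2 fun x h1 h2 => absurd h1.2 (not_le.2 h2.1)

theorem count_finset (X : Finset ℝ) (B : Set ℝ) :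
    count X.val B = (open Classical in X.filter (· ∈ B)).card := by
  classical
  rw [count, Multiset.countP_eq_card_filter]
  rfl

/-- The cell `(j / N, (j + 1) / N]`. -/
def cell (N j : ℕ) : Set ℝ := Ioc ((j : ℝ) / N) ((j + 1 : ℝ) / N)

/-- The numbers of points in the cells of side length `1 / N`. -/
noncomputable def cellCount (N : ℕ) (s : Multiset ℝ) (j : ℕ) : ℕ := count s (cell N j)

/-- The occupation indicators of the cells of side length `1 / N`. -/
noncomputable def occ (N : ℕ) (s : Multiset ℝ) (j : ℕ) : ℕ := min (cellCount N s j) 1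

theorem occ_le_one (N : ℕ) (s : Multiset ℝ) (j : ℕ) : occ N s j ≤ 1 := min_le_right _ _

theorem occ_eq_one_iff {N : ℕ} {s : Multiset ℝ} {j : ℕ} :
    occ N s j = 1 ↔ ∃ x ∈ s, x ∈ cell N j := by
  rw [← count_pos_iff]
  unfold occ cellCount
  omega

theorem mem_cell_iff {N : ℕ} (hN : 0 < N) {j : ℕ} {x : ℝ} :
    x ∈ cell N j ↔ (j : ℝ) < N * x ∧ N * x ≤ j + 1 := by
  have : (0 : ℝ) < N := by exact_mod_cast hN
  rw [cell, mem_Ioc, div_lt_iff₀ this, le_div_iff₀ this, mul_comm x]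

theorem cell_unique {N : ℕ} (hN : 0 < N) {i j : ℕ} {x : ℝ} (hi : x ∈ cell N i)
    (hj : x ∈ cell N j) : i = j := by
  rw [mem_cell_iff hN] at hi hj
  have h1 : (i : ℝ) < j + 1 := by linarith
  have h2 : (j : ℝ) < i + 1 := by linarith
  norm_cast at h1 h2
  omega

theorem exists_mem_cell {N : ℕ} (hN : 0 < N) {x : ℝ} (hx : x ∈ Ioc (0 : ℝ) 1) :
    ∃ i < N, x ∈ cell N i := by
  have hN' : (0 : ℝ) < N := by exact_mod_cast hN
  have h0 : 0 < ⌈(N : ℝ) * x⌉₊ := Nat.ceil_pos.2 (mul_pos hN' hx.1)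
  have h1 : ⌈(N : ℝ) * x⌉₊ ≤ N := Nat.ceil_le.2 (by nlinarith [hx.2])
  refine ⟨⌈(N : ℝ) * x⌉₊ - 1, by omega, ?_⟩
  rw [mem_cell_iff hN]
  have h2 := Nat.lt_ceil.1 (show ⌈(N : ℝ) * x⌉₊ - 1 < ⌈(N : ℝ) * x⌉₊ by omega)
  refine ⟨h2, (Nat.le_ceil _).trans ?_⟩
  exact_mod_cast (by omega : ⌈(N : ℝ) * x⌉₊ ≤ ⌈(N : ℝ) * x⌉₊ - 1 + 1)

theorem abs_sub_lt_of_mem_cell {N : ℕ} (hN : 0 < N) {i : ℕ} {x y : ℝ} (hx : x ∈ cell N i)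
    (hy : y ∈ cell N i) : |x - y| < 1 / N := by
  have hN' : (0 : ℝ) < N := by exact_mod_cast hN
  rw [mem_cell_iff hN] at hx hy
  rw [abs_lt, lt_div_iff₀ hN', ← neg_lt, neg_sub, lt_div_iff₀ hN']
  constructor <;> nlinarith

theorem cellCount_cons {N : ℕ} (hN : 0 < N) {a : ℝ} {i : ℕ} (ha : a ∈ cell N i)
    (s : Multiset ℝ) :
    cellCount N (a ::ₘ s) = Function.update (cellCount N s) i (cellCount N s i + 1) := by
  ext j
  rcases eq_or_ne j i with rfl | hj
  · simp [cellCount, count_cons, ha]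
  · have : a ∉ cell N j := fun h => hj (cell_unique hN h ha)
    simp [cellCount, count_cons, this, hj]

theorem coarsen_occ {n : ℕ} (hn : 0 < n) (s : Multiset ℝ) : coarsen (occ (2 * n) s) = occ n s := by
  ext i
  have hn' : (0 : ℝ) < n := by exact_mod_cast hn
  have e1 : ((2 * i + 1 : ℕ) : ℝ) / (2 * n : ℕ) = (2 * i + 1) / (2 * n) := by push_cast; rfl
  have : cellCount (2 * n) s (2 * i) + cellCount (2 * n) s (2 * i + 1) = cellCount n s i := by
    have h := count_Ioc_add s (a := (i : ℝ) / n) (b := (2 * i + 1) / (2 * n))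
      (c := (i + 1 : ℝ) / n) (by rw [div_le_div_iff₀ hn' (by positivity)]; nlinarith)
      (by rw [div_le_div_iff₀ (by positivity) hn']; nlinarith)
    rw [cellCount, cellCount, cellCount, cell, cell, cell, ← h]
    congr 3 <;> (push_cast; field_simp <;> ring)
  unfold coarsen occ
  omega

theorem sum_cellCount (N : ℕ) (s : Multiset ℝ) {i j : ℕ} (hij : i ≤ j) :
    ∑ r ∈ Finset.Ico i j, cellCount N s r = count s (Ioc ((i : ℝ) / N) ((j : ℝ) / N)) := by
  induction j, hij using Nat.le_induction with
  | base => simp [eq_comm (a := 0), count_eq_zero_iff]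
  | succ j hj ih =>
    have : (i : ℝ) ≤ j := by exact_mod_cast hj
    rw [Finset.sum_Ico_succ_top hj, ih, cellCount, cell, count_Ioc_add, Nat.cast_succ]
    · gcongr
    · gcongr; linarith

theorem scan_lt_iff {w : ℝ} (hw : w ≤ 1) {s : Multiset ℝ} {k : ℕ} :
    scan w s < k ↔ ∀ t ∈ Icc 0 (1 - w), count s (Ioc t (t + w)) < k := by
  have h := isGreatest_scan hw s
  constructor
  · intro hk t ht
    exact (h.2 ⟨t, ht, rfl⟩).trans_lt hk
  · intro hk
    obtain ⟨t, ht, hts⟩ := h.1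
    rw [← hts]
    exact hk t ht

theorem scan_mono {w : ℝ} (hw : w ≤ 1) (a : ℝ) (s : Multiset ℝ) : scan w s ≤ scan w (a ::ₘ s) := by
  classical
  by_contra! h
  obtain ⟨t, ht, hts⟩ := (isGreatest_scan hw s).1
  have := (scan_lt_iff hw).1 h t ht
  simp only at hts
  rw [count_cons] at this
  omega

theorem scan_cons_le {w : ℝ} (hw : w ≤ 1) (a : ℝ) (s : Multiset ℝ) :
    scan w (a ::ₘ s) ≤ scan w s + 1 := by
  classical
  rw [← Nat.lt_succ_iff, scan_lt_iff hw]
  intro t ht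
  have := (isGreatest_scan hw s).2 ⟨t, ht, rfl⟩
  simp only at this
  rw [count_cons]
  split_ifs <;> omega

/-! ### Convergence of the discrete functionals for a fixed configuration -/

section Pointwise

variable {p q : ℕ}

theorem tendsto_cell_length (hq : 0 < q) :
    Tendsto (fun m : ℕ => 1 / ((m * q : ℕ) : ℝ)) atTop (𝓝 0) := by
  refine (tendsto_const_nhds.div_atTop ?_)
  refine tendsto_natCast_atTop_atTop.comp ?_
  exact tendsto_id.atTop_mul_const' hq

theorem window_div {m : ℕ} (hm : 0 < m) (hq : 0 < q) (i : ℕ) :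
    ((i + m * p : ℕ) : ℝ) / (m * q : ℕ) = (i : ℝ) / (m * q : ℕ) + (p : ℝ) / q := by
  have : (0 : ℝ) < m := by exact_mod_cast hm
  have : (0 : ℝ) < q := by exact_mod_cast hq
  push_cast
  field_simp

/-- The discrete windows form a subfamily of the continuous ones. Conversely, a continuous window
`(t, t + w]` can be moved to the next grid point on the right, and on a fine grid it does not lose
points thereby. -/
theorem eventually_windowScan_cellCount (hp : 0 < p) (hpq : p < q) (s : Multiset ℝ) :
    ∀ᶠ m : ℕ in atTop, windowScan (m * q) (m * p) (cellCount (m * q) s) = scan ((p : ℝ) / q) s := by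
  have hq : 0 < q := hp.trans hpq
  have hq' : (0 : ℝ) < q := by exact_mod_cast hq
  have hw : (p : ℝ) / q ≤ 1 := by
    rw [div_le_one hq']
    exact_mod_cast hpq.le
  have hg := isGreatest_scan hw s
  obtain ⟨t, ht, hts⟩ := hg.1
  have hev : ∀ᶠ m : ℕ in atTop, ∀ x ∈ s.toFinset, t < x → 1 / ((m * q : ℕ) : ℝ) < x - t := by
    rw [Filter.eventually_all_finset]
    intro x _
    by_cases hx : t < x
    · filter_upwards [(tendsto_cell_length hq).eventually_lt_const (sub_pos.2 hx)] with m hm _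
      exact hm
    · exact Eventually.of_forall fun m h => absurd h hx
  filter_upwards [hev, eventually_gt_atTop 0] with m hm hm0
  have hn : 0 < m * q := by positivity
  have hn' : (0 : ℝ) < (m * q : ℕ) := by exact_mod_cast hn
  have hLn : m * p ≤ m * q := Nat.mul_le_mul_left m hpq.le
  have hwn : (p : ℝ) / q * (m * q : ℕ) = (m * p : ℕ) := by
    push_cast; field_simp
  apply le_antisymm
  · refine Finset.sup_le fun i hi => ?_
    simp only [Finset.mem_range] at hi
    rw [sum_cellCount _ _ (by omega), window_div hm0 hq]
    refine hg.2 ⟨(i : ℝ) / (m * q : ℕ), ⟨by positivity, ?_⟩, rfl⟩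
    rw [div_le_iff₀ hn', sub_mul, hwn, one_mul, ← Nat.cast_sub hLn]
    exact_mod_cast (by omega)
  · simp only at hts
    rw [← hts]
    set i := ⌈((m * q : ℕ) : ℝ) * t⌉₊ with hi
    have hti : ((m * q : ℕ) : ℝ) * t ≤ i := Nat.le_ceil _
    have hit : (i : ℝ) < ((m * q : ℕ) : ℝ) * t + 1 :=
      Nat.ceil_lt_add_one (mul_nonneg hn'.le ht.1)
    have hiL : i ≤ m * q - m * p := by
      refine Nat.ceil_le.2 ?_
      rw [Nat.cast_sub hLn, ← hwn]
      nlinarith [ht.2]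
    have hle : count s (Ioc t (t + (p : ℝ) / q)) ≤
        ∑ r ∈ Finset.Ico i (i + m * p), cellCount (m * q) s r := by
      rw [sum_cellCount _ _ (by omega), window_div hm0 hq]
      refine count_mono fun x hx hxt => ⟨?_, hxt.2.trans ?_⟩
      · have := hm x (Multiset.mem_toFinset.2 hx) hxt.1
        rw [div_lt_iff₀ hn'] at this ⊢
        linarith
      · gcongr
        rw [le_div_iff₀ hn']
        linarith
    exact hle.trans (Finset.le_sup (f := fun i => ∑ r ∈ Finset.Ico i (i + m * p),
      cellCount (m * q) s r) (by simp only [Finset.mem_range]; omega))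

theorem eventually_separated (hq : 0 < q) (X : Finset ℝ) (c : ℝ) :
    ∀ᶠ m : ℕ in atTop, ∀ x ∈ X, ∀ y ∈ X, x ≠ y + c → 1 / ((m * q : ℕ) : ℝ) < |x - (y + c)| := by
  rw [Filter.eventually_all_finset]
  intro x _
  rw [Filter.eventually_all_finset]
  intro y _
  by_cases hxy : x = y + c
  · exact Eventually.of_forall fun m h => absurd hxy h
  · filter_upwards [(tendsto_cell_length hq).eventually_lt_const
      (abs_pos.2 (sub_ne_zero.2 hxy))] with m hm _
    exact hm

theorem occ_eq_cellCount {N : ℕ} (hN : 0 < N) {X : Finset ℝ}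
    (hsep : ∀ x ∈ X, ∀ y ∈ X, x ≠ y → 1 / (N : ℝ) < |x - y|) :
    occ N X.val = cellCount N X.val := by
  classical
  ext j
  refine min_eq_left ?_
  rw [cellCount, count_finset, Finset.card_le_one]
  intro x hx y hy
  simp only [Finset.mem_filter] at hx hy
  by_contra hne
  exact (hsep x hx.1 y hy.1 hne).not_gt (abs_sub_lt_of_mem_cell hN hx.2 hy.2)

theorem eventually_windowScan_occ (hp : 0 < p) (hpq : p < q) (X : Finset ℝ) :
    ∀ᶠ m : ℕ in atTop, windowScan (m * q) (m * p) (occ (m * q) X.val) =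
      scan ((p : ℝ) / q) X.val := by
  have hq : 0 < q := hp.trans hpq
  filter_upwards [eventually_separated hq X 0, eventually_windowScan_cellCount hp hpq X.val,
    eventually_gt_atTop 0] with m hm hm' hm0
  simp only [add_zero] at hm
  rw [occ_eq_cellCount (by positivity) hm, hm']

/-- If distinct points lie in distinct cells, then counting occupied cells with a property amounts
to counting the points. -/
theorem card_occupied_cells {N M : ℕ} (hN : 0 < N) {X : Finset ℝ}
    (hX : ∀ x ∈ X, x ∈ Ioc (0 : ℝ) 1)
    (hsep : ∀ x ∈ X, ∀ y ∈ X, x ≠ y → 1 / (N : ℝ) < |x - y|) (R : ℕ → Prop) (R' : ℝ → Prop)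
    {_ : DecidablePred R'} {_ : DecidablePred fun i => occ N X.val i = 1 ∧ R i}
    (h : ∀ x ∈ X, ∀ i, x ∈ cell N i → (i < M ∧ R i ↔ R' x)) :
    ((Finset.range M).filter fun i => occ N X.val i = 1 ∧ R i).card = (X.filter R').card := by
  symm
  have hex : ∀ x ∈ X, ∃ i, x ∈ cell N i := fun x hx =>
    (exists_mem_cell hN (hX x hx)).imp fun i hi => hi.2
  choose! f hf using hex
  refine Finset.card_bij (fun x _ => f x) ?_ ?_ ?_
  · intro x hx
    simp only [Finset.mem_filter, Finset.mem_range] at hx ⊢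
    have := (h x hx.1 _ (hf x hx.1)).2 hx.2
    exact ⟨this.1, occ_eq_one_iff.2 ⟨x, hx.1, hf x hx.1⟩, this.2⟩
  · intro x hx y hy hxy
    simp only [Finset.mem_filter] at hx hy
    by_contra hne
    exact (hsep x hx.1 y hy.1 hne).not_gt
      (abs_sub_lt_of_mem_cell hN (hf x hx.1) (hxy ▸ hf y hy.1))
  · intro i hi
    simp only [Finset.mem_filter, Finset.mem_range] at hi
    obtain ⟨x, hx, hxi⟩ := occ_eq_one_iff.1 hi.2.1
    exact ⟨x, Finset.mem_filter.2 ⟨hx, (h x hx i hxi).1 ⟨hi.1, hi.2.2⟩⟩,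
      cell_unique hN (hf x hx) hxi⟩

open Classical in
/-- The discrete counterpart of `nu`: the number of occupied cells `i` such that an additional point
in cell `i + L` makes the pair critical. -/
noncomputable def pairCount (n L k : ℕ) (h : ℕ → ℕ) : ℕ :=
  ((Finset.range (n - L)).filter fun i => h i = 1 ∧ PairCritical n L k i h).card

open Classical in
/-- The discrete counterpart of `nuTilde`: the number of occupied cells in which a second point
lifts the scan statistic to `k`. -/
noncomputable def doubleCount (n L k : ℕ) (h : ℕ → ℕ) : ℕ :=
  ((Finset.range n).filter fun i => h i = 1 ∧ DoubleCritical n L k i h).card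

theorem eventually_doubleCount (hp : 0 < p) (hpq : p < q) (k : ℕ) {X : Finset ℝ}
    (hX : ∀ x ∈ X, x ∈ Ioc (0 : ℝ) 1) :
    ∀ᶠ m : ℕ in atTop, doubleCount (m * q) (m * p) k (occ (m * q) X.val) =
      nuTilde k ((p : ℝ) / q) X := by
  have hq : 0 < q := hp.trans hpq
  have hw : (p : ℝ) / q ≤ 1 := by
    rw [div_le_one (by exact_mod_cast hq)]
    exact_mod_cast hpq.le
  have hev : ∀ᶠ m : ℕ in atTop, ∀ x ∈ X, windowScan (m * q) (m * p)
      (cellCount (m * q) (x ::ₘ X.val)) = scan ((p : ℝ) / q) (x ::ₘ X.val) := by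
    rw [Filter.eventually_all_finset]
    exact fun x _ => eventually_windowScan_cellCount hp hpq _
  filter_upwards [eventually_separated hq X 0, eventually_windowScan_occ hp hpq X, hev,
    eventually_gt_atTop 0] with m hsep hm hm' hm0
  simp only [add_zero] at hsep
  have hN : 0 < m * q := by positivity
  unfold doubleCount nuTilde
  refine card_occupied_cells hN hX hsep _ _ fun x hx i hi => ?_
  have hiN : i < m * q := by
    obtain ⟨j, hj, hj'⟩ := exists_mem_cell hN (hX x hx)
    rwa [cell_unique hN hi hj']
  have h1 : occ (m * q) X.val i = 1 := occ_eq_one_iff.2 ⟨x, hx, hi⟩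
  have h2 : Function.update (occ (m * q) X.val) i 1 = occ (m * q) X.val := by
    rw [← h1, Function.update_eq_self]
  have h3 : Function.update (occ (m * q) X.val) i 2 = cellCount (m * q) (x ::ₘ X.val) := by
    rw [cellCount_cons hN hi, ← occ_eq_cellCount hN hsep, h1]
  have h4 := scan_cons_le hw x X.val
  rw [DoubleCritical, h2, h3, hm, hm' x hx]
  omega

/-- For a configuration without coincidences, adding a point at distance `w` after `x` keeps the
scan statistic below `k` if and only if it is below `k` and no window around `x + w` has more than
`k - 2` points. -/
theorem scan_cons_lt_iff {w : ℝ} (hw0 : 0 < w) (hw : w ≤ 1) {X : Finset ℝ}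
    (hX : ∀ x ∈ X, x ∈ Ioc (0 : ℝ) 1) {x : ℝ} (hx : 0 ≤ x) (hxw : x < 1 - w)
    (hgen : x + 2 * w ∉ X) {k : ℕ} :
    scan w ((x + w) ::ₘ X.val) < k ↔ scan w X.val < k ∧
      ∀ t : ℝ, x ≤ t → t ≤ x + w → count X.val (Ioc t (t + w)) + 2 ≤ k := by
  classical
  constructor
  · intro h
    refine ⟨(scan_mono hw _ _).trans_lt h, fun t hxt htx => ?_⟩
    -- shift the window `(t, t + w]` to the left, without losing points, until it catches `x + w`
    obtain ⟨t₁, h1, h2, h3, h4⟩ : ∃ t₁, x ≤ t₁ ∧ t₁ < x + w ∧ t₁ ≤ t ∧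
        ∀ y ∈ X, y ≤ t + w → y ≤ t₁ + w := by
      rcases htx.lt_or_eq with hlt | rfl
      · exact ⟨t, hxt, hlt, le_rfl, fun y _ h => h⟩
      · have hev : ∀ᶠ t₁ in 𝓝[<] (x + w), ∀ y ∈ X, y ≤ x + w + w → y < t₁ + w := by
          rw [Filter.eventually_all_finset]
          intro y hy
          by_cases hyx : y ≤ x + w + w
          · have : y < x + w + w :=
              hyx.lt_of_ne fun h => hgen (by rwa [show x + 2 * w = y by rw [h]; ring])
            filter_upwards [(eventually_gt_nhds (show y - w < x + w by linarith)).filter_mono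
              nhdsWithin_le_nhds] with t₁ ht₁ _
            linarith
          · exact Eventually.of_forall fun _ h => absurd h hyx
        obtain ⟨t₁, h1, h2⟩ := (hev.and (Ioo_mem_nhdsLT (show x < x + w by linarith))).exists
        exact ⟨t₁, h2.1.le, h2.2, h2.2.le, fun y hy hy' => (h1 y hy hy').le⟩
    have h5 := (scan_lt_iff hw).1 h (min t₁ (1 - w)) ⟨by simp; constructor <;> linarith, by simp⟩
    have h6 : x + w ∈ Ioc (min t₁ (1 - w)) (min t₁ (1 - w) + w) :=
      ⟨(min_le_left _ _).trans_lt h2, by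
        have : x ≤ min t₁ (1 - w) := le_min h1 hxw.le
        linarith⟩
    rw [count_cons, if_pos h6] at h5
    have h7 : count X.val (Ioc t (t + w)) ≤
        count X.val (Ioc (min t₁ (1 - w)) (min t₁ (1 - w) + w)) := by
      refine count_mono fun y hy hyt => ⟨(min_le_left _ _).trans_lt (h3.trans_lt hyt.1), ?_⟩
      rw [min_add, sub_add_cancel]
      exact le_min (h4 y hy hyt.2) (hX y hy).2
    omega
  · rintro ⟨h1, h2⟩
    rw [scan_lt_iff hw] at h1 ⊢
    intro t ht
    have h3 := h1 t ht
    rw [count_cons]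
    split_ifs with h
    · have := h2 t (by linarith [h.2]) h.1.le
      omega
    · omega

/-- Configurations in general position with respect to windows of length `w`. -/
structure IsGeneric (w : ℝ) (X : Finset ℝ) : Prop where
  ne_add : ∀ x ∈ X, ∀ y ∈ X, x ≠ y + w
  ne_add_two_mul : ∀ x ∈ X, ∀ y ∈ X, x ≠ y + 2 * w
  one_sub_notMem : 1 - w ∉ X

theorem eventually_pairCount (hp : 0 < p) (hpq : p < q) (k : ℕ) {X : Finset ℝ}
    (hX : ∀ x ∈ X, x ∈ Ioc (0 : ℝ) 1) (hgen : IsGeneric ((p : ℝ) / q) X) :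
    ∀ᶠ m : ℕ in atTop, pairCount (m * q) (m * p) k (occ (m * q) X.val) =
      nu k ((p : ℝ) / q) X := by
  have hq : 0 < q := hp.trans hpq
  have hq' : (0 : ℝ) < q := by exact_mod_cast hq
  have hw0 : 0 < (p : ℝ) / q := by have : (0 : ℝ) < p := by exact_mod_cast hp
                                   positivity
  have hw : (p : ℝ) / q ≤ 1 := by
    rw [div_le_one hq']
    exact_mod_cast hpq.le
  have hev : ∀ᶠ m : ℕ in atTop, ∀ x ∈ X, windowScan (m * q) (m * p)
      (cellCount (m * q) ((x + (p : ℝ) / q) ::ₘ X.val)) =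
        scan ((p : ℝ) / q) ((x + (p : ℝ) / q) ::ₘ X.val) := by
    rw [Filter.eventually_all_finset]
    exact fun x _ => eventually_windowScan_cellCount hp hpq _
  filter_upwards [eventually_separated hq X 0, eventually_separated hq X ((p : ℝ) / q), hev,
    eventually_gt_atTop 0] with m hsep hsep' hm hm0
  simp only [add_zero] at hsep
  have hN : 0 < m * q := by positivity
  have hN' : (0 : ℝ) < (m * q : ℕ) := by exact_mod_cast hN
  have hL : 0 < m * p := by positivity
  have hLn : m * p ≤ m * q := Nat.mul_le_mul_left m hpq.le
  have hwn : ((m * q : ℕ) : ℝ) * ((p : ℝ) / q) = (m * p : ℕ) := by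
    push_cast; field_simp
  have hocc := occ_eq_cellCount hN hsep
  unfold pairCount nu
  refine card_occupied_cells hN hX hsep _ _ fun x hx i hi => ?_
  have hi' := (mem_cell_iff hN).1 hi
  have hiff : i < m * q - m * p ↔ x < 1 - (p : ℝ) / q := by
    constructor
    · intro h
      refine lt_of_le_of_ne ?_ fun h => hgen.one_sub_notMem (h ▸ hx)
      have h2 : (i : ℝ) + 1 ≤ ((m * q : ℕ) : ℝ) - (m * p : ℕ) := by
        rw [← Nat.cast_sub hLn]; exact_mod_cast h
      rw [← hwn] at h2
      nlinarith
    · intro h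
      have h2 : (i : ℝ) < ((m * q : ℕ) : ℝ) - (m * p : ℕ) := by
        rw [← hwn]
        nlinarith
      rw [← Nat.cast_sub hLn] at h2
      exact_mod_cast h2
  rw [hiff]
  refine and_congr_right fun hxw => ?_
  have hmid : ∑ r ∈ Finset.Ico (i + 1) (i + m * p), occ (m * q) X.val r =
      count X.val (Ioc x (x + (p : ℝ) / q)) := by
    rw [hocc, sum_cellCount _ _ (by omega), window_div hm0 hq]
    refine count_congr fun y hy => ?_
    rw [mem_Ioc, mem_Ioc, div_lt_iff₀ hN', Nat.cast_succ]
    have h0 : y ≠ x → 1 < |(m * q : ℕ) * y - (m * q : ℕ) * x| := by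
      intro hne
      have := hsep y hy x hx hne
      rwa [div_lt_iff₀ hN', mul_comm, ← abs_of_pos hN', ← abs_mul, mul_sub] at this
    have h1 : 1 < |(m * q : ℕ) * y - (m * q : ℕ) * (x + (p : ℝ) / q)| := by
      have := hsep' y hy x hx (hgen.ne_add y hy x hx)
      rwa [div_lt_iff₀ hN', mul_comm, ← abs_of_pos hN', ← abs_mul, mul_sub] at this
    rw [lt_abs] at h0 h1
    have h3 : y ≤ (i : ℝ) / (m * q : ℕ) + (p : ℝ) / q ↔
        (m * q : ℕ) * y ≤ i + (m * q : ℕ) * ((p : ℝ) / q) := by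
      rw [← sub_le_iff_le_add, le_div_iff₀ hN', ← sub_le_iff_le_add, sub_mul, mul_comm y,
        mul_comm ((p : ℝ) / q)]
    rw [h3]
    constructor
    · rintro ⟨h4, h5⟩
      constructor
      · nlinarith
      · by_contra! h
        rcases h1 with h1 | h1 <;> nlinarith
    · rintro ⟨h4, h5⟩
      have h6 := h0 h4.ne'
      constructor
      · rcases h6 with h6 | h6 <;> nlinarith
      · rcases h1 with h1 | h1 <;> nlinarith
  have hxi : x + (p : ℝ) / q ∈ cell (m * q) (i + m * p) := by
    rw [mem_cell_iff hN, mul_add, hwn, Nat.cast_add]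
    constructor <;> linarith [hi'.1, hi'.2]
  have h1 : occ (m * q) X.val i = 1 := occ_eq_one_iff.2 ⟨x, hx, hi⟩
  have h2 : Function.update (occ (m * q) X.val) i 1 = occ (m * q) X.val := by
    rw [← h1, Function.update_eq_self]
  have h3 : cellCount (m * q) X.val (i + m * p) = 0 := by
    refine count_eq_zero_iff.2 fun y hy hyi => ?_
    exact (hsep' y hy x hx (hgen.ne_add y hy x hx)).not_gt (abs_sub_lt_of_mem_cell hN hyi hxi)
  have h4 : Function.update (occ (m * q) X.val) (i + m * p) 1 =
      cellCount (m * q) ((x + (p : ℝ) / q) ::ₘ X.val) := by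
    rw [cellCount_cons hN hxi, h3, hocc]
  rw [PairCritical, h2, h4, hm x hx, hmid, scan_cons_lt_iff hw0 hw hX (hX x hx).1.le hxw
    (fun h => hgen.ne_add_two_mul _ h x hx rfl)]
  tauto

end Pointwise

/-! ### Independent indicators on the fine grid -/

section Indicators

variable {Ω : Type*} [MeasurableSpace Ω] {P : Measure Ω} {g : ℕ → Ω → ℕ}

theorem measurable_of_dependsOn {α : Type*} [MeasurableSpace α] (hm : ∀ j, Measurable (g j))
    {T : Finset ℕ} {f : (ℕ → ℕ) → α} (hf : DependsOn f (T : Set ℕ)) :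
    Measurable fun ω => f fun j => g j ω := by
  classical
  have h1 : (fun ω => f fun j => g j ω) =
      (fun u : T → ℕ => f fun j => if h : j ∈ T then u ⟨j, h⟩ else 0) ∘
        fun ω (i : T) => g i ω := by
    ext ω
    refine hf fun j hj => ?_
    simp [Finset.mem_coe.1 hj]
  rw [h1]
  exact Measurable.of_discrete.comp (measurable_pi_lambda _ fun i => hm i)

theorem measurableSet_of_dependsOn (hm : ∀ j, Measurable (g j)) {T : Finset ℕ}
    {Φ : (ℕ → ℕ) → Prop} (hΦ : DependsOn Φ (T : Set ℕ)) :
    MeasurableSet {ω | Φ fun j => g j ω} :=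
  measurableSet_setOfPred.2 (measurable_of_dependsOn hm hΦ)

/-- Prescribed values on `S` are independent of a property that depends on indices outside `S`. -/
theorem measureReal_pattern_inter (hm : ∀ j, Measurable (g j)) (hi : iIndepFun g P)
    {S T : Finset ℕ} (hST : Disjoint S T) (pat : ℕ → ℕ) {Φ : (ℕ → ℕ) → Prop}
    (hΦ : DependsOn Φ (T : Set ℕ)) :
    P.real {ω | (∀ j ∈ S, g j ω = pat j) ∧ Φ fun j => g j ω} =
      (∏ j ∈ S, P.real {ω | g j ω = pat j}) * P.real {ω | Φ fun j => g j ω} := by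
  classical
  have hind := hi.indepFun_finset S T hST hm
  have h1 := hind.measure_inter_preimage_eq_mul {u | ∀ j : S, u j = pat j}
    {u | Φ fun j => if h : j ∈ T then u ⟨j, h⟩ else 0} (MeasurableSet.of_discrete)
    (MeasurableSet.of_discrete)
  have h2 : {ω | Φ fun j => g j ω} = (fun ω (i : T) => g i ω) ⁻¹'
      {u | Φ fun j => if h : j ∈ T then u ⟨j, h⟩ else 0} := by
    ext ω
    have : (Φ fun j => g j ω) = Φ fun j => if h : j ∈ T then g j ω else 0 :=
      hΦ fun j hj => by simp [Finset.mem_coe.1 hj]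
    simp [this]
  have h3 : (fun ω (i : S) => g i ω) ⁻¹' {u | ∀ j : S, u j = pat j} =
      ⋂ j ∈ S, g j ⁻¹' {pat j} := by
    ext ω; simp
  have h4 := (iIndepFun_iff_measure_inter_preimage_eq_mul.1 hi) S (sets := fun j => {pat j})
    fun j _ => measurableSet_singleton _
  rw [← h2, h3, h4] at h1
  rw [measureReal_def, measureReal_def, show {ω | (∀ j ∈ S, g j ω = pat j) ∧ Φ fun j => g j ω} =
    (⋂ j ∈ S, g j ⁻¹' {pat j}) ∩ {ω | Φ fun j => g j ω} by ext ω; simp, h1, ENNReal.toReal_mul,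
    ENNReal.toReal_prod]
  rfl

variable [IsProbabilityMeasure P]

theorem integrable_card_filter {ι : Type*} (s : Finset ι) {Q : ι → Ω → Prop}
    [∀ ω, DecidablePred fun i => Q i ω] (hQ : ∀ i ∈ s, MeasurableSet {ω | Q i ω}) :
    Integrable (fun ω => ((s.filter fun i => Q i ω).card : ℝ)) P := by
  simp only [Finset.card_filter, Nat.cast_sum]
  refine integrable_finsetSum _ fun i hi => ?_
  refine ((integrable_const (1 : ℝ)).indicator (hQ i hi)).congr (Eventually.of_forall fun ω => ?_)
  by_cases h : Q i ω <;> simp [h]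

theorem integral_card_filter {ι : Type*} (s : Finset ι) {Q : ι → Ω → Prop}
    [∀ ω, DecidablePred fun i => Q i ω] (hQ : ∀ i ∈ s, MeasurableSet {ω | Q i ω}) :
    ∫ ω, ((s.filter fun i => Q i ω).card : ℝ) ∂P = ∑ i ∈ s, P.real {ω | Q i ω} := by
  have h : ∀ i ω, (((if Q i ω then 1 else 0 : ℕ)) : ℝ) = {ω | Q i ω}.indicator 1 ω := by
    intro i ω
    by_cases h : Q i ω <;> simp [h]
  simp only [Finset.card_filter, Nat.cast_sum, h]
  rw [integral_finsetSum]
  · exact Finset.sum_congr rfl fun i hi => integral_indicator_one (hQ i hi)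
  · exact fun i hi => (integrable_const (1 : ℝ)).indicator (hQ i hi)

variable {n L k : ℕ} {ρ : ℝ}

theorem pairCritical_dependsOn (hLn : L ≤ n) {i : ℕ} (hi : i < n - L) :
    DependsOn (fun u : ℕ → ℕ => PairCritical n L k i (coarsen u))
      ((Finset.range (2 * n) \ {2 * i, 2 * i + 1, 2 * (i + L), 2 * (i + L) + 1} : Finset ℕ) :
        Set ℕ) := by
  intro x y hxy
  have hc : ∀ r < n, r ≠ i → r ≠ i + L → coarsen x r = coarsen y r := by
    intro r hr h1 h2
    unfold coarsen
    rw [hxy (2 * r) (by simp; omega), hxy (2 * r + 1) (by simp; omega)]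
  have h1 : ∑ r ∈ Finset.Ico (i + 1) (i + L), coarsen x r =
      ∑ r ∈ Finset.Ico (i + 1) (i + L), coarsen y r := by
    refine Finset.sum_congr rfl fun r hr => ?_
    have := Finset.mem_Ico.1 hr
    exact hc r (by omega) (by omega) (by omega)
  have h2 : windowScan n L (Function.update (Function.update (coarsen x) i 1) (i + L) 1) =
      windowScan n L (Function.update (Function.update (coarsen y) i 1) (i + L) 1) := by
    refine windowScan_dependsOn hLn fun r hr => ?_
    have hr' : r < n := by simpa using hr
    simp only [Function.update_apply]
    split_ifs with h1 h2
    · rfl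
    · rfl
    · exact hc r hr' h2 h1
  simp only [PairCritical, h1, h2]

theorem doubleCritical_dependsOn (hLn : L ≤ n) {i : ℕ} :
    DependsOn (fun u : ℕ → ℕ => DoubleCritical n L k i (coarsen u))
      ((Finset.range (2 * n) \ {2 * i, 2 * i + 1} : Finset ℕ) : Set ℕ) := by
  intro x y hxy
  have h (c : ℕ) : windowScan n L (Function.update (coarsen x) i c) =
      windowScan n L (Function.update (coarsen y) i c) := by
    refine windowScan_dependsOn hLn fun r hr => ?_
    have hr' : r < n := by simpa using hr
    simp only [Function.update_apply]
    split_ifs with h1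
    · rfl
    · unfold coarsen
      rw [hxy (2 * r) (by simp; omega), hxy (2 * r + 1) (by simp; omega)]
  simp only [DoubleCritical, h]

theorem measureReal_eq_zero_value (hm : ∀ j, Measurable (g j)) (hg : ∀ j ω, g j ω ≤ 1) {j : ℕ}
    (hρ : P.real {ω | g j ω = 1} = ρ) : P.real {ω | g j ω = 0} = 1 - ρ := by
  rw [← hρ, ← probReal_compl_eq_one_sub (s := {ω | g j ω = 1})
    (hm j (measurableSet_singleton 1))]
  congr 1
  ext ω
  have := hg j ω
  simp only [mem_ofPred_eq, mem_compl_iff]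
  omega

theorem measureReal_forall_eq_one (hm : ∀ j, Measurable (g j)) (hi : iIndepFun g P) {N : ℕ}
    (hρ : ∀ j < N, P.real {ω | g j ω = 1} = ρ) {S : Finset ℕ} (hS : ∀ j ∈ S, j < N) :
    P.real {ω | ∀ j ∈ S, g j ω = 1} = ρ ^ S.card := by
  have h := measureReal_pattern_inter (P := P) hm hi (Finset.disjoint_empty_right S) (fun _ => 1)
    (Φ := fun _ => True) (fun _ _ _ => rfl)
  simp only [and_true, ofPred_true, probReal_univ, mul_one] at h
  rw [h, Finset.prod_congr rfl fun j hj => hρ j (hS j hj), Finset.prod_const]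

/-- Cell `i` is occupied with probability `1 - (1 - ρ) ^ 2`, independently of what happens in other
cells. -/
theorem measureReal_coarsen_eq_one_inter (hm : ∀ j, Measurable (g j)) (hi : iIndepFun g P)
    (hg : ∀ j ω, g j ω ≤ 1) (hρ : ∀ j < 2 * n, P.real {ω | g j ω = 1} = ρ) {i : ℕ} (hin : i < n)
    {T : Finset ℕ} (h0 : 2 * i ∉ T) (h1 : 2 * i + 1 ∉ T) {Φ : (ℕ → ℕ) → Prop}
    (hΦ : DependsOn Φ (T : Set ℕ)) :
    P.real {ω | coarsen (fun j => g j ω) i = 1 ∧ Φ fun j => g j ω} =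
      ρ * (2 - ρ) * P.real {ω | Φ fun j => g j ω} := by
  have hd : Disjoint {2 * i, 2 * i + 1} T := by
    simp [h0, h1]
  have h := measureReal_pattern_inter (P := P) hm hi hd (fun _ => 0) hΦ
  rw [Finset.prod_pair (by omega), measureReal_eq_zero_value hm hg (hρ _ (by omega)),
    measureReal_eq_zero_value hm hg (hρ _ (by omega))] at h
  have hmeas : MeasurableSet {ω | (∀ j ∈ ({2 * i, 2 * i + 1} : Finset ℕ), g j ω = 0) ∧
      Φ fun j => g j ω} := by
    rw [ofPred_and]
    refine MeasurableSet.inter ?_ (measurableSet_of_dependsOn hm hΦ)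
    have : {ω | ∀ j ∈ ({2 * i, 2 * i + 1} : Finset ℕ), g j ω = 0} =
        ⋂ j ∈ ({2 * i, 2 * i + 1} : Finset ℕ), g j ⁻¹' {0} := by ext; simp
    rw [this]
    exact Finset.measurableSet_biInter _ fun j _ => hm j (measurableSet_singleton 0)
  have hsub : {ω | coarsen (fun j => g j ω) i = 1 ∧ Φ fun j => g j ω} =
      {ω | Φ fun j => g j ω} \ {ω | (∀ j ∈ ({2 * i, 2 * i + 1} : Finset ℕ), g j ω = 0) ∧
        Φ fun j => g j ω} := by
    ext ω
    have e0 := hg (2 * i) ω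
    have e1 := hg (2 * i + 1) ω
    simp only [coarsen, mem_ofPred_eq, Set.mem_sdiff, Finset.mem_insert, Finset.mem_singleton,
      forall_eq_or_imp, forall_eq, not_and]
    constructor
    · rintro ⟨h2, h3⟩
      exact ⟨h3, fun h4 => by omega⟩
    · rintro ⟨h2, h3⟩
      exact ⟨by by_contra h4; exact h3 (by omega) h2, h2⟩
  rw [hsub, measureReal_sdiff (s₁ := {ω | Φ fun j => g j ω}) (fun ω h => h.2) hmeas, h]
  ring

theorem measureReal_pairGain (hm : ∀ j, Measurable (g j)) (hi : iIndepFun g P)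
    (hg : ∀ j ω, g j ω ≤ 1) (hρ : ∀ j < 2 * n, P.real {ω | g j ω = 1} = ρ) (hρ1 : ρ ≤ 1)
    (hL : 1 ≤ L) (hLn : L ≤ n) {i : ℕ} (hin : i < n - L) :
    P.real {ω | PairGain n L k i fun j => g j ω} = ρ * (1 - ρ) ^ 2 / (2 - ρ) *
      P.real {ω | coarsen (fun j => g j ω) i = 1 ∧
        PairCritical n L k i (coarsen fun j => g j ω)} := by
  have hdep := pairCritical_dependsOn (k := k) hLn hin
  rw [measureReal_coarsen_eq_one_inter (P := P) hm hi hg hρ (show i < n by omega) (by simp)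
    (by simp) hdep]
  have h := measureReal_pattern_inter (P := P) hm hi Finset.disjoint_sdiff
    (fun j => if j = 2 * i + 1 ∨ j = 2 * (i + L) then 1 else 0) hdep
  have e0 : ¬ (2 * i = 2 * i + 1 ∨ 2 * i = 2 * (i + L)) := by omega
  have e1 : ¬ (2 * (i + L) + 1 = 2 * i + 1 ∨ 2 * (i + L) + 1 = 2 * (i + L)) := by omega
  rw [Finset.prod_insert (by simp; omega), Finset.prod_insert (by simp; omega),
    Finset.prod_pair (by omega)] at h
  simp only [Finset.mem_insert, Finset.mem_singleton, forall_eq_or_imp, forall_eq,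
    if_neg e0, if_neg e1, true_or, or_true, if_true] at h
  rw [hρ _ (by omega), hρ _ (by omega), measureReal_eq_zero_value hm hg (hρ _ (by omega)),
    measureReal_eq_zero_value hm hg (hρ _ (by omega))] at h
  unfold PairGain
  rw [h]
  have : 2 - ρ ≠ 0 := by linarith
  field_simp

theorem measureReal_doubleGain (hm : ∀ j, Measurable (g j)) (hi : iIndepFun g P)
    (hg : ∀ j ω, g j ω ≤ 1) (hρ : ∀ j < 2 * n, P.real {ω | g j ω = 1} = ρ) (hρ1 : ρ ≤ 1)
    (hLn : L ≤ n) {i : ℕ} (hin : i < n) :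
    P.real {ω | DoubleGain n L k i fun j => g j ω} = ρ / (2 - ρ) *
      P.real {ω | coarsen (fun j => g j ω) i = 1 ∧
        DoubleCritical n L k i (coarsen fun j => g j ω)} := by
  have hdep := doubleCritical_dependsOn (k := k) (i := i) hLn
  rw [measureReal_coarsen_eq_one_inter (P := P) hm hi hg hρ hin (by simp) (by simp) hdep]
  have h := measureReal_pattern_inter (P := P) hm hi Finset.disjoint_sdiff (fun j => 1) hdep
  rw [Finset.prod_pair (by omega)] at h
  simp only [Finset.mem_insert, Finset.mem_singleton, forall_eq_or_imp, forall_eq] at h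
  rw [hρ _ (by omega), hρ _ (by omega)] at h
  unfold DoubleGain
  rw [h]
  have : 2 - ρ ≠ 0 := by linarith
  field_simp

theorem pairGain_dependsOn (hLn : L ≤ n) {i : ℕ} (hi : i < n - L) :
    DependsOn (PairGain n L k i) (Finset.range (2 * n) : Set ℕ) := by
  intro x y hxy
  have h := (pairCritical_dependsOn (k := k) hLn hi).mono (by simp) hxy
  unfold PairGain
  rw [h, hxy _ (by simp; omega), hxy _ (by simp; omega), hxy _ (by simp; omega),
    hxy _ (by simp; omega)]

theorem doubleGain_dependsOn (hLn : L ≤ n) {i : ℕ} (hi : i < n) :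
    DependsOn (DoubleGain n L k i) (Finset.range (2 * n) : Set ℕ) := by
  intro x y hxy
  have h := (doubleCritical_dependsOn (k := k) (i := i) hLn).mono (by simp) hxy
  unfold DoubleGain
  rw [h, hxy _ (by simp; omega), hxy _ (by simp; omega)]

theorem coarsen_eq_one_and_pairCritical_dependsOn (hLn : L ≤ n) {i : ℕ} (hi : i < n - L) :
    DependsOn (fun u : ℕ → ℕ => coarsen u i = 1 ∧ PairCritical n L k i (coarsen u))
      (Finset.range (2 * n) : Set ℕ) := by
  intro x y hxy
  have h := (pairCritical_dependsOn (k := k) hLn hi).mono (by simp) hxy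
  simp only [coarsen] at h ⊢
  rw [h, hxy _ (by simp; omega), hxy _ (by simp; omega)]

theorem coarsen_eq_one_and_doubleCritical_dependsOn (hLn : L ≤ n) {i : ℕ} (hi : i < n) :
    DependsOn (fun u : ℕ → ℕ => coarsen u i = 1 ∧ DoubleCritical n L k i (coarsen u))
      (Finset.range (2 * n) : Set ℕ) := by
  intro x y hxy
  have h := (doubleCritical_dependsOn (k := k) (i := i) hLn).mono (by simp) hxy
  simp only [coarsen] at h ⊢
  rw [h, hxy _ (by simp; omega), hxy _ (by simp; omega)]

theorem integrable_gainCount (hm : ∀ j, Measurable (g j)) (hLn : L ≤ n) :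
    Integrable (fun ω => (gainCount n L k fun j => g j ω : ℝ)) P := by
  classical
  simp only [gainCount, Nat.cast_add]
  exact (integrable_card_filter _ fun i hi => measurableSet_of_dependsOn hm
    (pairGain_dependsOn hLn (Finset.mem_range.1 hi))).add (integrable_card_filter _ fun i hi =>
      measurableSet_of_dependsOn hm (doubleGain_dependsOn hLn (Finset.mem_range.1 hi)))

/-- Whether a cell is critical is independent of the occupation of the cells that make up the gain,
so each expected number of gains is a multiple of the expected number of occupied critical cells. -/
theorem integral_gainCount (hm : ∀ j, Measurable (g j)) (hi : iIndepFun g P)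
    (hg : ∀ j ω, g j ω ≤ 1) (hρ : ∀ j < 2 * n, P.real {ω | g j ω = 1} = ρ) (hρ1 : ρ ≤ 1)
    (hL : 1 ≤ L) (hLn : L ≤ n) :
    ∫ ω, (gainCount n L k fun j => g j ω : ℝ) ∂P =
      ρ * (1 - ρ) ^ 2 / (2 - ρ) * ∫ ω, (pairCount n L k (coarsen fun j => g j ω) : ℝ) ∂P +
      ρ / (2 - ρ) * ∫ ω, (doubleCount n L k (coarsen fun j => g j ω) : ℝ) ∂P := by
  classical
  simp only [gainCount, Nat.cast_add, pairCount, doubleCount]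
  have h1 : ∀ i ∈ Finset.range (n - L), MeasurableSet {ω | PairGain n L k i fun j => g j ω} :=
    fun i hi => measurableSet_of_dependsOn hm (pairGain_dependsOn hLn (Finset.mem_range.1 hi))
  have h2 : ∀ i ∈ Finset.range n, MeasurableSet {ω | DoubleGain n L k i fun j => g j ω} :=
    fun i hi => measurableSet_of_dependsOn hm (doubleGain_dependsOn hLn (Finset.mem_range.1 hi))
  rw [integral_add (integrable_card_filter _ h1) (integrable_card_filter _ h2),
    integral_card_filter _ h1, integral_card_filter _ h2, integral_card_filter,
    integral_card_filter, Finset.mul_sum, Finset.mul_sum]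
  · congr 1
    · exact Finset.sum_congr rfl fun i hin =>
        measureReal_pairGain hm hi hg hρ hρ1 hL hLn (Finset.mem_range.1 hin)
    · exact Finset.sum_congr rfl fun i hin =>
        measureReal_doubleGain hm hi hg hρ hρ1 hLn (Finset.mem_range.1 hin)
  · exact fun i hi => measurableSet_of_dependsOn hm
      (coarsen_eq_one_and_doubleCritical_dependsOn hLn (Finset.mem_range.1 hi))
  · exact fun i hi => measurableSet_of_dependsOn hm
      (coarsen_eq_one_and_pairCritical_dependsOn hLn (Finset.mem_range.1 hi))

/-! ### Two simultaneous coincidences -/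

/-- The fine cells `b` such that `(a, b)` may be a pair of `coincidencePairs`. -/
def laterPartners (L a : ℕ) : Finset ℕ := {2 * (a / 2) + 1, 2 * (a / 2 + L), 2 * (a / 2 + L) + 1}

/-- The fine cells `a` such that `(a, b)` may be a pair of `coincidencePairs`. -/
def earlierPartners (L b : ℕ) : Finset ℕ := {2 * (b / 2), 2 * (b / 2 - L), 2 * (b / 2 - L) + 1}

theorem mem_coincidencePairs {e : ℕ × ℕ} : e ∈ coincidencePairs n L ↔
    (e.1 < 2 * n ∧ e.2 < 2 * n) ∧ e.1 < e.2 ∧ (e.2 / 2 = e.1 / 2 ∨ e.2 / 2 = e.1 / 2 + L) := by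
  simp [coincidencePairs]

theorem mem_laterPartners {e : ℕ × ℕ} (he : e ∈ coincidencePairs n L) :
    e.2 ∈ laterPartners L e.1 := by
  rw [mem_coincidencePairs] at he
  simp only [laterPartners, Finset.mem_insert, Finset.mem_singleton]
  omega

theorem mem_earlierPartners {e : ℕ × ℕ} (he : e ∈ coincidencePairs n L) :
    e.1 ∈ earlierPartners L e.2 := by
  rw [mem_coincidencePairs] at he
  simp only [earlierPartners, Finset.mem_insert, Finset.mem_singleton]
  omega

theorem card_coincidencePairs_le : (coincidencePairs n L).card ≤ 6 * n := by
  have h : coincidencePairs n L ⊆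
      (Finset.range (2 * n)).biUnion fun a => (laterPartners L a).image (Prod.mk a) := by
    intro e he
    have h1 := mem_laterPartners he
    rw [mem_coincidencePairs] at he
    simp only [Finset.mem_biUnion, Finset.mem_range, Finset.mem_image]
    exact ⟨e.1, he.1.1, e.2, h1, rfl⟩
  refine (Finset.card_le_card h).trans (Finset.card_biUnion_le.trans ?_)
  calc _ ≤ ∑ a ∈ Finset.range (2 * n), 3 :=
        Finset.sum_le_sum fun a _ => Finset.card_image_le.trans Finset.card_le_three
    _ = 6 * n := by simp; ring

/-- The pairs of `coincidencePairs` having a cell in common with `e`. -/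
def touchingPairs (n L : ℕ) (e : ℕ × ℕ) : Finset (ℕ × ℕ) :=
  (coincidencePairs n L).filter fun f => f.1 = e.1 ∨ f.1 = e.2 ∨ f.2 = e.1 ∨ f.2 = e.2

theorem card_touchingPairs_le (e : ℕ × ℕ) : (touchingPairs n L e).card ≤ 12 := by
  have h : touchingPairs n L e ⊆ ({e.1, e.2} : Finset ℕ).biUnion fun v =>
      (laterPartners L v).image (Prod.mk v) ∪ (earlierPartners L v).image fun a => (a, v) := by
    rintro ⟨a, b⟩ hf
    simp only [touchingPairs, Finset.mem_filter] at hf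
    have h1 := mem_laterPartners hf.1
    have h2 := mem_earlierPartners hf.1
    simp only [Finset.mem_biUnion, Finset.mem_union, Finset.mem_image, Finset.mem_insert,
      Finset.mem_singleton]
    rcases hf.2 with h3 | h3 | h3 | h3
    · exact ⟨e.1, Or.inl rfl, Or.inl ⟨b, h3 ▸ h1, by rw [← h3]⟩⟩
    · exact ⟨e.2, Or.inr rfl, Or.inl ⟨b, h3 ▸ h1, by rw [← h3]⟩⟩
    · exact ⟨e.1, Or.inl rfl, Or.inr ⟨a, h3 ▸ h2, by rw [← h3]⟩⟩
    · exact ⟨e.2, Or.inr rfl, Or.inr ⟨a, h3 ▸ h2, by rw [← h3]⟩⟩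
  refine (Finset.card_le_card h).trans (Finset.card_biUnion_le.trans ?_)
  calc _ ≤ ∑ v ∈ ({e.1, e.2} : Finset ℕ), 6 := Finset.sum_le_sum fun v _ =>
        (Finset.card_union_le _ _).trans (Nat.add_le_add
          (Finset.card_image_le.trans Finset.card_le_three)
          (Finset.card_image_le.trans Finset.card_le_three))
    _ ≤ 12 := by
        rw [Finset.sum_const, smul_eq_mul]
        have := Finset.card_le_two (a := e.1) (b := e.2)
        omega

theorem offDiag_coincidences (u : ℕ → ℕ) : (coincidences n L u).offDiag =
    (coincidencePairs n L).offDiag.filter fun f =>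
      ∀ j ∈ ({f.1.1, f.1.2, f.2.1, f.2.2} : Finset ℕ), u j = 1 := by
  ext f
  simp [coincidences, Finset.mem_offDiag]
  tauto

theorem measurableSet_forall_eq_one (hm : ∀ j, Measurable (g j)) (S : Finset ℕ) :
    MeasurableSet {ω | ∀ j ∈ S, g j ω = 1} := by
  have : {ω | ∀ j ∈ S, g j ω = 1} = ⋂ j ∈ S, g j ⁻¹' {1} := by ext; simp
  rw [this]
  exact Finset.measurableSet_biInter _ fun j _ => hm j (measurableSet_singleton 1)

theorem integrable_card_offDiag (hm : ∀ j, Measurable (g j)) :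
    Integrable (fun ω => ((coincidences n L fun j => g j ω).offDiag.card : ℝ)) P := by
  simp only [offDiag_coincidences]
  exact integrable_card_filter _ fun f _ => measurableSet_forall_eq_one hm _

/-- Two different coincidences involve at least four cells, or else three cells, and the latter
can be chosen in only `O(n)` ways. -/
theorem integral_card_offDiag_le (hm : ∀ j, Measurable (g j)) (hi : iIndepFun g P)
    (hρ : ∀ j < 2 * n, P.real {ω | g j ω = 1} = ρ) (hρ0 : 0 ≤ ρ) :
    ∫ ω, ((coincidences n L fun j => g j ω).offDiag.card : ℝ) ∂P ≤
      72 * n * ρ ^ 3 + 36 * n ^ 2 * ρ ^ 4 := by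
  classical
  simp only [offDiag_coincidences]
  rw [integral_card_filter _ fun f _ => measurableSet_forall_eq_one hm _]
  set E := coincidencePairs n L with hE
  have hcard : (E.card : ℝ) ≤ 6 * n := by exact_mod_cast card_coincidencePairs_le
  have hterm : ∀ f ∈ E.offDiag,
      P.real {ω | ∀ j ∈ ({f.1.1, f.1.2, f.2.1, f.2.2} : Finset ℕ), g j ω = 1} ≤
        (if f.2 ∈ touchingPairs n L f.1 then ρ ^ 3 else 0) + ρ ^ 4 := by
    rintro ⟨⟨a, b⟩, c, d⟩ hf
    simp only [Finset.mem_offDiag, hE, mem_coincidencePairs, ne_eq, Prod.mk.injEq, not_and] at hf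
    obtain ⟨h1, h2, h3⟩ := hf
    have of_subset : ∀ S : Finset ℕ, (∀ j ∈ S, j = a ∨ j = b ∨ j = c ∨ j = d) →
        P.real {ω | ∀ j ∈ ({a, b, c, d} : Finset ℕ), g j ω = 1} ≤ ρ ^ S.card := by
      intro S hS
      rw [← measureReal_forall_eq_one hm hi hρ (S := S) fun j hj => by
        have := hS j hj; omega]
      refine measureReal_mono fun ω hω j hj => hω j ?_
      simpa using hS j hj
    split_ifs with ht
    · have h4 : ∃ v, (v = c ∨ v = d) ∧ v ≠ a ∧ v ≠ b := by
        by_contra! h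
        have := h c (Or.inl rfl)
        have := h d (Or.inr rfl)
        omega
      obtain ⟨v, hv, hva, hvb⟩ := h4
      have h5 := of_subset {v, a, b} (by simp; omega)
      rw [Finset.card_eq_three.2 ⟨v, a, b, hva, hvb, by omega, rfl⟩] at h5
      have : 0 ≤ ρ ^ 4 := by positivity
      linarith
    · simp only [touchingPairs, Finset.mem_filter, mem_coincidencePairs, not_and, not_or] at ht
      have h4 := ht h2
      have h5 := of_subset {a, b, c, d} (by simp)
      rw [Finset.card_insert_of_notMem (by simp; omega), Finset.card_insert_of_notMem
        (by simp; omega), Finset.card_pair (by omega)] at h5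
      simpa using h5
  have h3 : 0 ≤ ρ ^ 3 := by positivity
  have h4 : 0 ≤ ρ ^ 4 := by positivity
  have hsub : ∀ (F : (ℕ × ℕ) × (ℕ × ℕ) → ℝ), (∀ f, 0 ≤ F f) →
      ∑ f ∈ E.offDiag, F f ≤ ∑ e ∈ E, ∑ f ∈ E, F (e, f) := by
    intro F hF
    rw [← Finset.sum_product']
    exact Finset.sum_le_sum_of_subset_of_nonneg
      (fun f hf => by simp_all [Finset.mem_offDiag]) fun f _ _ => hF f
  calc _ ≤ ∑ f ∈ E.offDiag, ((if f.2 ∈ touchingPairs n L f.1 then ρ ^ 3 else 0) + ρ ^ 4) :=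
        Finset.sum_le_sum hterm
    _ ≤ ∑ e ∈ E, ∑ f ∈ E, ((if f ∈ touchingPairs n L e then ρ ^ 3 else 0) + ρ ^ 4) :=
        hsub (fun f => (if f.2 ∈ touchingPairs n L f.1 then ρ ^ 3 else 0) + ρ ^ 4) fun f => by
          split_ifs <;> positivity
    _ ≤ ∑ e ∈ E, (12 * ρ ^ 3 + E.card * ρ ^ 4) := by
        refine Finset.sum_le_sum fun e _ => ?_
        rw [Finset.sum_add_distrib, Finset.sum_const, nsmul_eq_mul, ← Finset.sum_filter,
          Finset.sum_const, nsmul_eq_mul]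
        gcongr
        exact_mod_cast (Finset.card_le_card fun f hf => (Finset.mem_filter.1 hf).2).trans
          (card_touchingPairs_le e)
    _ = E.card * (12 * ρ ^ 3 + E.card * ρ ^ 4) := by rw [Finset.sum_const, nsmul_eq_mul]
    _ ≤ (6 * n) * (12 * ρ ^ 3 + (6 * n) * ρ ^ 4) := by gcongr
    _ = _ := by ring

/-! ### The probability of a jump -/

theorem scanJump_dependsOn (hLn : L ≤ n) :
    DependsOn (ScanJump n L k) (Finset.range (2 * n) : Set ℕ) := by
  intro x y hxy
  have h1 := windowScan_dependsOn (Nat.mul_le_mul_left 2 hLn) hxy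
  have h2 : windowScan n L (coarsen x) = windowScan n L (coarsen y) := by
    refine windowScan_dependsOn hLn fun r hr => ?_
    have hr' : r < n := by simpa using hr
    unfold coarsen
    rw [hxy _ (by simp; omega), hxy _ (by simp; omega)]
  simp only [ScanJump, h1, h2]

/-- The probability of a jump of the scan statistic, up to terms of second order. -/
theorem abs_measureReal_scanJump_sub_le (hm : ∀ j, Measurable (g j)) (hi : iIndepFun g P)
    (hg : ∀ j ω, g j ω ≤ 1) (hρ : ∀ j < 2 * n, P.real {ω | g j ω = 1} = ρ) (hρ0 : 0 ≤ ρ)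
    (hρ1 : ρ ≤ 1) (hL : 1 ≤ L) (hLn : L ≤ n) (hk : 0 < k) :
    |P.real {ω | ScanJump n L k fun j => g j ω} -
      (ρ * (1 - ρ) ^ 2 / (2 - ρ) * ∫ ω, (pairCount n L k (coarsen fun j => g j ω) : ℝ) ∂P +
      ρ / (2 - ρ) * ∫ ω, (doubleCount n L k (coarsen fun j => g j ω) : ℝ) ∂P)| ≤
      72 * n * ρ ^ 3 + 36 * n ^ 2 * ρ ^ 4 := by
  classical
  have hA := measurableSet_of_dependsOn hm (scanJump_dependsOn (k := k) hLn)
  have hind : Integrable ({ω | ScanJump n L k fun j => g j ω}.indicator (1 : Ω → ℝ)) P :=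
    (integrable_const (1 : ℝ)).indicator hA
  rw [← integral_gainCount hm hi hg hρ hρ1 hL hLn, ← integral_indicator_one hA,
    ← integral_sub hind (integrable_gainCount hm hLn)]
  refine (abs_integral_le_integral_abs).trans
    (le_trans ?_ (integral_card_offDiag_le (L := L) hm hi hρ hρ0))
  refine integral_mono (hind.sub (integrable_gainCount hm hLn)).abs (integrable_card_offDiag hm)
    fun ω => ?_
  have h := abs_scanJump_sub_gainCount_le hL hLn hk (fun j => hg j ω)
  simp only [indicator_apply, mem_ofPred_eq, Pi.one_apply]
  convert h

end Indicators

/-! ### The cells of a Poisson process -/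

section Poisson

variable {Ω : Type*} [MeasurableSpace Ω] {P : Measure Ω} {lam : ℝ} {X : Ω → Finset ℝ}

theorem measurableSet_cell (N j : ℕ) : MeasurableSet (cell N j) := measurableSet_Ioc

theorem pairwise_disjoint_cell {N : ℕ} (hN : 0 < N) :
    Pairwise fun i j => Disjoint (cell N i) (cell N j) := fun _ _ hij =>
  Set.disjoint_left.2 fun _ hi hj => hij (cell_unique hN hi hj)

theorem IsPoissonProcess.measurable_occ (hX : IsPoissonProcess P lam X) (N j : ℕ) :
    Measurable fun ω => occ N (X ω).val j :=
  (hX.measurable_count _ (measurableSet_cell N j)).min measurable_const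

theorem IsPoissonProcess.iIndepFun_occ (hX : IsPoissonProcess P lam X) {N : ℕ} (hN : 0 < N) :
    iIndepFun (fun j ω => occ N (X ω).val j) P := by
  have h : iIndepFun (fun j ω => cellCount N (X ω).val j) P := by
    rw [iIndepFun_iff_finset]
    intro s
    refine iIndepFun.of_precomp (g := s.equivFin.symm) s.equivFin.symm.surjective ?_
    refine hX.indep_count _ (fun i => cell N (s.equivFin.symm i))
      (fun i => measurableSet_cell _ _) fun i j hij => pairwise_disjoint_cell hN ?_
    exact fun h => hij (s.equivFin.symm.injective (Subtype.ext h))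
  exact h.comp (fun _ c => min c 1) fun _ => Measurable.of_discrete

theorem cell_subset {N j : ℕ} (hj : j < N) : cell N j ⊆ Ioc 0 1 := by
  have hN : (0 : ℝ) < N := by exact_mod_cast (Nat.zero_le j).trans_lt hj
  have hj' : (j : ℝ) + 1 ≤ N := by exact_mod_cast hj
  exact Ioc_subset_Ioc (by positivity) ((div_le_one hN).2 hj')

theorem IsPoissonProcess.measureReal_count_eq_zero (hX : IsPoissonProcess P lam X) (hlam : 0 < lam)
    {B : Set ℝ} (hB : MeasurableSet B) (hB' : B ⊆ Ioc 0 1) :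
    P.real {ω | count (X ω).val B = 0} = Real.exp (-(lam * volume.real B)) := by
  have h := congrArg (fun μ : Measure ℕ => μ.real {0}) (hX.map_count B hB hB')
  rw [map_measureReal_apply (hX.measurable_count B hB) (measurableSet_singleton 0),
    poissonMeasure_real_singleton, Real.coe_toNNReal _ (by positivity)] at h
  rw [show {ω | count (X ω).val B = 0} = (fun ω => count (X ω).val B) ⁻¹' {0} from rfl, h]
  simp

theorem IsPoissonProcess.measureReal_occ_eq_zero (hX : IsPoissonProcess P lam X) (hlam : 0 < lam)
    {N j : ℕ} (hj : j < N) :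
    P.real {ω | occ N (X ω).val j = 0} = Real.exp (-lam / N) := by
  have h := hX.measureReal_count_eq_zero hlam (measurableSet_cell N j) (cell_subset hj)
  rw [cell, Real.volume_real_Ioc_of_le (by gcongr; linarith), ← sub_div, add_sub_cancel_left,
    mul_one_div, ← neg_div] at h
  rw [← h]
  congr 1
  ext ω
  simp [occ, cellCount, cell]

theorem IsPoissonProcess.measureReal_occ_eq_one [IsProbabilityMeasure P]
    (hX : IsPoissonProcess P lam X) (hlam : 0 < lam) {N j : ℕ} (hj : j < N) :
    P.real {ω | occ N (X ω).val j = 1} = 1 - Real.exp (-lam / N) := by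
  rw [← hX.measureReal_occ_eq_zero hlam hj, ← probReal_compl_eq_one_sub
    (s := {ω | occ N (X ω).val j = 0}) (hX.measurable_occ N j (measurableSet_singleton 0))]
  congr 1
  ext ω
  have := occ_le_one N (X ω).val j
  simp only [mem_ofPred_eq, mem_compl_iff]
  omega

/-- A probability measure on `ℕ` that is carried by `{0, 1}` is determined by the masses of these
two points. -/
theorem eq_of_measureReal_zero_one {μ ν : Measure ℕ} [IsProbabilityMeasure μ]
    [IsProbabilityMeasure ν] (h0 : μ.real {0} = ν.real {0}) (h1 : μ.real {1} = ν.real {1})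
    (h : μ.real {0} + μ.real {1} = 1) : μ = ν := by
  have key : ∀ (κ : Measure ℕ) [IsProbabilityMeasure κ], κ.real {0} + κ.real {1} = 1 →
      ∀ a, a ≠ 0 → a ≠ 1 → κ.real {a} = 0 := by
    intro κ _ hκ a ha0 ha1
    have h2 : κ.real ({0} ∪ {1} ∪ {a}) = 1 + κ.real {a} := by
      rw [measureReal_union (by simp; omega) (measurableSet_singleton a),
        measureReal_union (by simp) (measurableSet_singleton 1), hκ]
    have h3 : κ.real ({0} ∪ {1} ∪ {a}) ≤ 1 := measureReal_le_one
    have h4 : 0 ≤ κ.real {a} := measureReal_nonneg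
    linarith
  refine Measure.ext_of_singleton fun a => ?_
  have : μ.real {a} = ν.real {a} := by
    by_cases ha0 : a = 0
    · rw [ha0, h0]
    by_cases ha1 : a = 1
    · rw [ha1, h1]
    rw [key μ h a ha0 ha1, key ν (h0 ▸ h1 ▸ h) a ha0 ha1]
  rwa [measureReal_def, measureReal_def,
    ENNReal.toReal_eq_toReal_iff' (measure_ne_top _ _) (measure_ne_top _ _)] at this

/-- The indicators of the occupied cells of the Poisson process have the law of the Bernoulli
cells. -/
theorem IsBernoulliCells.measureReal_discreteScan [IsProbabilityMeasure P]
    (hX : IsPoissonProcess P lam X) (hlam : 0 < lam) {n L k : ℕ} (hn : 0 < n) (hL : L ≤ n)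
    {Ω' : Type*} [MeasurableSpace Ω'] {P' : Measure Ω'} [IsProbabilityMeasure P']
    {I : Fin n → Ω' → ℕ} (hI : IsBernoulliCells P' lam n I) :
    P'.real {ω | k ≤ discreteScan n L fun i => I i ω} =
      P.real {ω | k ≤ windowScan n L (occ n (X ω).val)} := by
  have hm : ∀ i : Fin n, Measurable fun ω => occ n (X ω).val i := fun i => hX.measurable_occ n i
  have h1 := (iIndepFun_iff_map_fun_eq_pi_map fun i => (hI.measurable i).aemeasurable).1 hI.indep
  have h2 := (iIndepFun_iff_map_fun_eq_pi_map (fun i => (hm i).aemeasurable)).1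
    ((hX.iIndepFun_occ hn).precomp (g := fun i : Fin n => (i : ℕ)) Fin.val_injective)
  have h3 : ∀ i : Fin n, P'.map (I i) = P.map fun ω => occ n (X ω).val i := by
    intro i
    have := Measure.isProbabilityMeasure_map (μ := P') (hI.measurable i).aemeasurable
    have := Measure.isProbabilityMeasure_map (μ := P) (hm i).aemeasurable
    have e0 := hI.prob_zero i
    have e1 := hI.prob_one i
    have e2 := hX.measureReal_occ_eq_zero hlam i.2
    have e3 := hX.measureReal_occ_eq_one hlam i.2
    have a0 : ∀ a, (P'.map (I i)).real {a} = P'.real {ω | I i ω = a} := fun a =>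
      map_measureReal_apply (hI.measurable i) (measurableSet_singleton a)
    have a1 : ∀ a, (P.map fun ω => occ n (X ω).val i).real {a} =
        P.real {ω | occ n (X ω).val i = a} := fun a =>
      map_measureReal_apply (hm i) (measurableSet_singleton a)
    refine eq_of_measureReal_zero_one ?_ ?_ ?_
    · rw [a0, a1, e0, e2]
    · rw [a0, a1, e1, e3]
    · rw [a0, a0, e0, e1]; ring
  have h4 : P'.map (fun ω i => I i ω) = P.map fun ω (i : Fin n) => occ n (X ω).val i := by
    rw [h1, h2]
    congr 1
    exact funext h3
  have h5 := congrArg (fun μ => μ.real {h | k ≤ discreteScan n L h}) h4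
  rw [map_measureReal_apply (measurable_pi_lambda _ hI.measurable) MeasurableSet.of_discrete,
    map_measureReal_apply (measurable_pi_lambda _ hm) MeasurableSet.of_discrete] at h5
  simp only [preimage_ofPred_eq, discreteScan_eq_windowScan hL] at h5
  exact h5

/-! ### Almost sure general position -/

/-- Two points of the process at the distance `d / q` lie in cells whose indices differ by exactly
`m * d` on the grid of side length `1 / (m * q)`. There are `O(m)` such pairs of cells, and both are
occupied with probability `O(1 / m ^ 2)`. -/
theorem IsPoissonProcess.ae_ne_add [IsProbabilityMeasure P] (hX : IsPoissonProcess P lam X)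
    (hlam : 0 < lam) {d q : ℕ} (hd : 0 < d) (hq : 0 < q) :
    ∀ᵐ ω ∂P, ∀ x ∈ X ω, ∀ y ∈ X ω, x ≠ y + (d : ℝ) / q := by
  have hq' : (0 : ℝ) < q := by exact_mod_cast hq
  have hbound : ∀ m : ℕ, 0 < m → P.real {ω | ¬ ∀ x ∈ X ω, ∀ y ∈ X ω, x ≠ y + (d : ℝ) / q} ≤
      lam ^ 2 * (1 / ((m * q : ℕ) : ℝ)) := by
    intro m hm
    have hN : 0 < m * q := by positivity
    have hN' : (0 : ℝ) < (m * q : ℕ) := by exact_mod_cast hN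
    set s := (Finset.range (m * q)).filter fun i => i + m * d < m * q with hs
    have hsub : {ω | ¬ ∀ x ∈ X ω, ∀ y ∈ X ω, x ≠ y + (d : ℝ) / q} ⊆ ⋃ i ∈ s,
        {ω | ∀ j ∈ ({i, i + m * d} : Finset ℕ), occ (m * q) (X ω).val j = 1} := by
      intro ω hω
      simp only [mem_ofPred_eq, not_forall, not_not] at hω
      obtain ⟨x, hx, y, hy, rfl⟩ := hω
      obtain ⟨i, hi, hyi⟩ := exists_mem_cell hN (hX.mem_Ioc ω y hy)
      obtain ⟨j, hj, hxj⟩ := exists_mem_cell hN (hX.mem_Ioc ω _ hx)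
      have hxi : y + (d : ℝ) / q ∈ cell (m * q) (i + m * d) := by
        rw [mem_cell_iff hN] at hyi ⊢
        have : ((m * q : ℕ) : ℝ) * (y + (d : ℝ) / q) = (m * q : ℕ) * y + (m * d : ℕ) := by
          push_cast; field_simp
        rw [this, Nat.cast_add]
        constructor <;> linarith [hyi.1, hyi.2]
      have := cell_unique hN hxi hxj
      simp only [mem_iUnion, mem_ofPred_eq, Finset.mem_insert, Finset.mem_singleton,
        forall_eq_or_imp, forall_eq]
      exact ⟨i, by simp [hs]; omega, occ_eq_one_iff.2 ⟨y, hy, hyi⟩, occ_eq_one_iff.2 ⟨_, hx, hxi⟩⟩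
    have hρ : 1 - Real.exp (-lam / (m * q : ℕ)) ≤ lam / (m * q : ℕ) := by
      have := Real.add_one_le_exp (-lam / (m * q : ℕ))
      rw [neg_div] at this ⊢
      linarith
    have hρ0 : 0 ≤ 1 - Real.exp (-lam / (m * q : ℕ)) := by
      rw [sub_nonneg, Real.exp_le_one_iff, neg_div, neg_nonpos]
      positivity
    have hmd : 0 < m * d := by positivity
    calc _ ≤ P.real (⋃ i ∈ s, {ω | ∀ j ∈ ({i, i + m * d} : Finset ℕ),
            occ (m * q) (X ω).val j = 1}) := measureReal_mono hsub (measure_ne_top _ _)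
      _ ≤ ∑ i ∈ s, P.real {ω | ∀ j ∈ ({i, i + m * d} : Finset ℕ), occ (m * q) (X ω).val j = 1} :=
          measureReal_biUnion_finset_le _ _
      _ ≤ ∑ i ∈ s, (lam / (m * q : ℕ)) ^ 2 := by
          refine Finset.sum_le_sum fun i hi => ?_
          simp only [hs, Finset.mem_filter, Finset.mem_range] at hi
          rw [measureReal_forall_eq_one (g := fun j ω => occ (m * q) (X ω).val j)
            (fun j => hX.measurable_occ _ j) (hX.iIndepFun_occ hN) (N := m * q)
            (fun j hj => hX.measureReal_occ_eq_one hlam hj) (by simp; omega),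
            Finset.card_pair (by omega)]
          gcongr
      _ ≤ (m * q : ℕ) * (lam / (m * q : ℕ)) ^ 2 := by
          rw [Finset.sum_const, nsmul_eq_mul]
          gcongr
          exact (Finset.card_filter_le _ _).trans (Finset.card_range _).le
      _ = _ := by field_simp
  have h0 : P.real {ω | ¬ ∀ x ∈ X ω, ∀ y ∈ X ω, x ≠ y + (d : ℝ) / q} ≤ 0 := by
    have hlim := (tendsto_cell_length hq).const_mul (lam ^ 2)
    rw [mul_zero] at hlim
    exact ge_of_tendsto hlim ((eventually_gt_atTop 0).mono hbound)
  rw [ae_iff]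
  exact (measureReal_eq_zero_iff).1 (le_antisymm h0 measureReal_nonneg)

theorem IsPoissonProcess.ae_notMem [IsProbabilityMeasure P] (hX : IsPoissonProcess P lam X)
    (hlam : 0 < lam) {c : ℝ} (hc : c ∈ Ioc (0 : ℝ) 1) : ∀ᵐ ω ∂P, c ∉ X ω := by
  have h := hX.measureReal_count_eq_zero hlam (measurableSet_singleton c)
    (singleton_subset_iff.2 hc)
  have h1 : P.real {ω | count (X ω).val {c} = 0}ᶜ = 0 := by
    rw [probReal_compl_eq_one_sub (s := {ω | count (X ω).val {c} = 0})
      (hX.measurable_count _ (measurableSet_singleton c) (measurableSet_singleton 0)), h,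
      measureReal_def, Real.volume_singleton]
    simp
  rw [measureReal_eq_zero_iff] at h1
  rw [ae_iff]
  refine measure_mono_null (fun ω hω => ?_) h1
  simp only [mem_ofPred_eq, not_not, mem_compl_iff] at hω ⊢
  exact (count_pos_iff.2 ⟨c, hω, mem_singleton c⟩).ne'

theorem IsPoissonProcess.ae_isGeneric [IsProbabilityMeasure P] (hX : IsPoissonProcess P lam X)
    (hlam : 0 < lam) {p q : ℕ} (hp : 0 < p) (hpq : p < q) :
    ∀ᵐ ω ∂P, IsGeneric ((p : ℝ) / q) (X ω) := by
  have hq : 0 < q := hp.trans hpq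
  have hq' : (0 : ℝ) < q := by exact_mod_cast hq
  have hw1 : (p : ℝ) / q < 1 := (div_lt_one hq').2 (by exact_mod_cast hpq)
  have hw0 : 0 ≤ (p : ℝ) / q := by positivity
  filter_upwards [hX.ae_ne_add hlam hp hq, hX.ae_ne_add hlam (d := 2 * p) (by omega) hq,
    hX.ae_notMem hlam (c := 1 - (p : ℝ) / q) ⟨by linarith, by linarith⟩] with ω h1 h2 h3
  refine ⟨h1, fun x hx y hy => ?_, h3⟩
  have := h2 x hx y hy
  push_cast at this
  rwa [mul_div_assoc] at this

/-! ### Passing to the limit -/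

theorem card_le_count (hX : IsPoissonProcess P lam X) (ω : Ω) :
    (X ω).card ≤ count (X ω).val (Ioc 0 1) := by
  classical
  rw [count_finset]
  refine Finset.card_le_card fun x hx => ?_
  simp only [Finset.mem_filter]
  exact ⟨hx, hX.mem_Ioc ω x hx⟩

theorem IsPoissonProcess.integrable_count (hX : IsPoissonProcess P lam X) :
    Integrable (fun ω => (count (X ω).val (Ioc 0 1) : ℝ)) P := by
  have hm := hX.measurable_count _ (measurableSet_Ioc (a := (0 : ℝ)) (b := 1))
  have h : Integrable (fun j : ℕ => (j : ℝ)) (P.map fun ω => count (X ω).val (Ioc 0 1)) := by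
    rw [hX.map_count _ measurableSet_Ioc subset_rfl, integrable_poissonMeasure_iff]
    generalize (lam * volume.real (Ioc (0 : ℝ) 1)).toNNReal = r
    rw [← summable_nat_add_iff 1]
    refine ((Real.summable_pow_div_factorial r).mul_left (Real.exp (-r) * r)).congr fun j => ?_
    rw [Nat.factorial_succ, Real.norm_natCast]
    push_cast
    have : ((j : ℝ) + 1) ≠ 0 := by positivity
    field_simp
    ring
  exact h.comp_measurable hm

theorem card_occupied_le {N : ℕ} (hN : 0 < N) (s : Multiset ℝ) :
    ((Finset.range N).filter fun i => occ N s i = 1).card ≤ count s (Ioc 0 1) := by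
  have hN' : (N : ℝ) ≠ 0 := by positivity
  have h := sum_cellCount N s (Nat.zero_le N)
  rw [div_self hN', Nat.cast_zero, zero_div] at h
  rw [← h, Finset.card_filter, Finset.range_eq_Ico]
  refine Finset.sum_le_sum fun i _ => ?_
  split_ifs with hi
  · unfold occ at hi; omega
  · exact Nat.zero_le _

theorem pairCount_occ_le {N : ℕ} (hN : 0 < N) (L k : ℕ) (s : Multiset ℝ) :
    pairCount N L k (occ N s) ≤ count s (Ioc 0 1) := by
  refine (Finset.card_le_card fun i hi => ?_).trans (card_occupied_le hN _)
  simp only [Finset.mem_filter, Finset.mem_range] at hi ⊢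
  exact ⟨by omega, hi.2.1⟩

theorem doubleCount_occ_le {N : ℕ} (hN : 0 < N) (L k : ℕ) (s : Multiset ℝ) :
    doubleCount N L k (occ N s) ≤ count s (Ioc 0 1) := by
  refine (Finset.card_le_card fun i hi => ?_).trans (card_occupied_le hN _)
  simp only [Finset.mem_filter, Finset.mem_range] at hi ⊢
  exact ⟨by omega, hi.2.1⟩

theorem nu_le (hX : IsPoissonProcess P lam X) (k : ℕ) (w : ℝ) (ω : Ω) :
    nu k w (X ω) ≤ count (X ω).val (Ioc 0 1) :=
  (Finset.card_le_card fun x hx => by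
    simp only [Finset.mem_filter] at hx; exact hx.1).trans (card_le_count hX ω)

theorem nuTilde_le (hX : IsPoissonProcess P lam X) (k : ℕ) (w : ℝ) (ω : Ω) :
    nuTilde k w (X ω) ≤ count (X ω).val (Ioc 0 1) :=
  (Finset.card_le_card fun x hx => by
    simp only [Finset.mem_filter] at hx; exact hx.1).trans (card_le_count hX ω)

theorem measurable_pairCount_occ (hX : IsPoissonProcess P lam X) {N L : ℕ} (hN : 0 < N)
    (hL : L ≤ N) (k : ℕ) : Measurable fun ω => pairCount N L k (occ N (X ω).val) := by
  simp only [← coarsen_occ hN]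
  refine measurable_of_dependsOn (fun j => hX.measurable_occ (2 * N) j)
    (f := fun u => pairCount N L k (coarsen u)) (T := Finset.range (2 * N)) fun x y hxy => ?_
  simp only [pairCount]
  congr 1
  ext i
  simp only [Finset.mem_filter]
  exact and_congr_right fun hi => iff_of_eq
    (coarsen_eq_one_and_pairCritical_dependsOn hL (Finset.mem_range.1 hi) hxy)

theorem measurable_doubleCount_occ (hX : IsPoissonProcess P lam X) {N L : ℕ} (hN : 0 < N)
    (hL : L ≤ N) (k : ℕ) : Measurable fun ω => doubleCount N L k (occ N (X ω).val) := by
  simp only [← coarsen_occ hN]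
  refine measurable_of_dependsOn (fun j => hX.measurable_occ (2 * N) j)
    (f := fun u => doubleCount N L k (coarsen u)) (T := Finset.range (2 * N)) fun x y hxy => ?_
  simp only [doubleCount]
  congr 1
  ext i
  simp only [Finset.mem_filter]
  exact and_congr_right fun hi => iff_of_eq
    (coarsen_eq_one_and_doubleCritical_dependsOn hL (Finset.mem_range.1 hi) hxy)

/-- Dominated convergence for a functional of the process that is almost surely the eventual value
of discrete functionals. -/
theorem integrable_and_tendsto_integral [IsProbabilityMeasure P] (hX : IsPoissonProcess P lam X)
    {F : ℕ → Ω → ℕ} {G : Ω → ℕ} (hF : ∀ m, 0 < m → Measurable (F m))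
    (hle : ∀ m, 0 < m → ∀ ω, F m ω ≤ count (X ω).val (Ioc 0 1))
    (hG : ∀ ω, G ω ≤ count (X ω).val (Ioc 0 1)) (h : ∀ᵐ ω ∂P, ∀ᶠ m in atTop, F m ω = G ω) :
    Integrable (fun ω => (G ω : ℝ)) P ∧
      Tendsto (fun m => ∫ ω, (F m ω : ℝ) ∂P) atTop (𝓝 (∫ ω, (G ω : ℝ) ∂P)) := by
  have hlim : ∀ᵐ ω ∂P, Tendsto (fun m => (F m ω : ℝ)) atTop (𝓝 (G ω : ℝ)) :=
    h.mono fun ω hω => tendsto_const_nhds.congr' (hω.mono fun m hm => by simp only [hm])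
  have hF' : ∀ m, 0 < m → AEStronglyMeasurable (fun ω => (F m ω : ℝ)) P := fun m hm =>
    (measurable_from_nat.comp (hF m hm)).aestronglyMeasurable
  constructor
  · refine hX.integrable_count.mono' (aestronglyMeasurable_of_tendsto_ae atTop
      (f := fun m ω => (F (m + 1) ω : ℝ)) (fun m => hF' _ m.succ_pos)
      (hlim.mono fun ω hω => (tendsto_add_atTop_iff_nat 1).2 hω)) (Eventually.of_forall fun ω => ?_)
    rw [Real.norm_natCast]
    exact_mod_cast hG ω
  · refine tendsto_integral_filter_of_dominated_convergence _
      ((eventually_gt_atTop 0).mono hF') ((eventually_gt_atTop 0).mono fun m hm =>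
        Eventually.of_forall fun ω => ?_) hX.integrable_count hlim
    rw [Real.norm_natCast]
    exact_mod_cast hle m hm ω

theorem tendsto_measureReal_windowScan [IsProbabilityMeasure P] (hX : IsPoissonProcess P lam X)
    {p q : ℕ} (hp : 0 < p) (hpq : p < q) (k : ℕ) :
    Tendsto (fun m : ℕ => P.real {ω | k ≤ windowScan (m * q) (m * p) (occ (m * q) (X ω).val)}) atTop
      (𝓝 (P.real {ω | k ≤ scan ((p : ℝ) / q) (X ω).val})) := by
  refine (ENNReal.tendsto_toReal (measure_ne_top _ _)).comp ?_
  refine tendsto_measure_of_tendsto_indicator_of_isFiniteMeasure atTop P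
    (fun m => ?_) fun ω => ?_
  · exact measurableSet_of_dependsOn (fun j => hX.measurable_occ (m * q) j)
      (le_windowScan_dependsOn (Nat.mul_le_mul_left m hpq.le) k)
  · filter_upwards [eventually_windowScan_occ hp hpq (X ω)] with m hm
    simp [hm]

/-! ### The rate of convergence -/

/-- If `m * (a (2 * m) - a m)` converges to `c`, then summing over the successive doublings of `m`
gives the rate of convergence of `a` itself. -/
theorem tendsto_mul_sub_of_doubling {a : ℕ → ℝ} {α c : ℝ} (ha : Tendsto a atTop (𝓝 α))
    (hd : Tendsto (fun m : ℕ => m * (a (2 * m) - a m)) atTop (𝓝 c)) :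
    Tendsto (fun m : ℕ => m * (α - a m)) atTop (𝓝 (2 * c)) := by
  rw [Metric.tendsto_atTop] at hd ⊢
  intro ε hε
  obtain ⟨M, hM⟩ := hd (ε / 4) (by positivity)
  refine ⟨M + 1, fun m hm => ?_⟩
  have hm0 : 0 < m := by omega
  have key : ∀ J : ℕ, |m * (a (2 ^ J * m) - a m) - 2 * c * (1 - (1 / 2) ^ J)| ≤
      2 * (ε / 4) * (1 - (1 / 2) ^ J) := by
    intro J
    induction J with
    | zero => simp
    | succ J ih =>
      have h1 := hM (2 ^ J * m) (by nlinarith [Nat.one_le_two_pow (n := J)])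
      rw [Real.dist_eq, abs_lt] at h1
      rw [abs_le] at ih ⊢
      have h2 : (m : ℝ) * (a (2 ^ (J + 1) * m) - a (2 ^ J * m)) = (1 / 2) ^ J *
          (((2 ^ J * m : ℕ) : ℝ) * (a (2 * (2 ^ J * m)) - a (2 ^ J * m))) := by
        rw [show 2 ^ (J + 1) * m = 2 * (2 ^ J * m) by ring]
        push_cast
        rw [one_div, inv_pow]
        field_simp
      have h3 : (0 : ℝ) < (1 / 2) ^ J := by positivity
      rw [pow_succ]
      generalize ((2 ^ J * m : ℕ) : ℝ) * (a (2 * (2 ^ J * m)) - a (2 ^ J * m)) = D at *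
      generalize (1 / 2 : ℝ) ^ J = r at *
      constructor <;> nlinarith
  have hlim : Tendsto (fun J : ℕ => |m * (a (2 ^ J * m) - a m) - 2 * c * (1 - (1 / 2) ^ J)|) atTop
      (𝓝 |m * (α - a m) - 2 * c * (1 - 0)|) := by
    have h1 : Tendsto (fun J : ℕ => 2 ^ J * m) atTop atTop :=
      (tendsto_pow_atTop_atTop_of_one_lt one_lt_two).atTop_mul_const' hm0
    have h2 : Tendsto (fun J : ℕ => (1 / 2 : ℝ) ^ J) atTop (𝓝 0) :=
      tendsto_pow_atTop_nhds_zero_of_lt_one (by norm_num) (by norm_num)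
    exact ((((ha.comp h1).sub_const _).const_mul _).sub ((h2.const_sub 1).const_mul _)).abs
  have h := le_of_tendsto hlim (b := 2 * (ε / 4)) (Eventually.of_forall fun J => by
    refine (key J).trans (mul_le_of_le_one_right (by positivity) ?_)
    linarith [show (0 : ℝ) < (1 / 2) ^ J by positivity])
  rw [sub_zero, mul_one] at h
  rw [Real.dist_eq]
  linarith

theorem tendsto_mul_one_sub_exp (c : ℝ) :
    Tendsto (fun x : ℝ => x * (1 - Real.exp (-(c / x)))) atTop (𝓝 c) := by
  have h : HasDerivAt (fun y : ℝ => 1 - Real.exp (-(c * y))) c 0 := by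
    have h1 : HasDerivAt (fun y : ℝ => -(c * y)) (-c) 0 := by
      simpa using ((hasDerivAt_id (0 : ℝ)).const_mul (-c))
    simpa using h1.exp.const_sub 1
  have h2 := (hasDerivAt_iff_tendsto_slope.1 h).comp
    (tendsto_inv_atTop_nhdsGT_zero.mono_right (nhdsWithin_mono _ fun x hx => ne_of_gt hx))
  refine h2.congr fun x => ?_
  simp [slope_def_field, div_eq_mul_inv, mul_comm]

/-- The scan statistic jumps between the grids of side lengths `1 / n` and `1 / (2 * n)` with a
probability of order `1 / n`. -/
theorem IsPoissonProcess.tendsto_mul_scanJump [IsProbabilityMeasure P]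
    (hX : IsPoissonProcess P lam X) (hlam : 0 < lam) {p q k : ℕ} (hp : 0 < p) (hpq : p < q)
    (hk : 0 < k) {A B : ℝ}
    (hA : Tendsto (fun m : ℕ => ∫ ω, (pairCount (m * q) (m * p) k (occ (m * q) (X ω).val) : ℝ) ∂P)
      atTop (𝓝 A))
    (hB : Tendsto (fun m : ℕ => ∫ ω, (doubleCount (m * q) (m * p) k (occ (m * q) (X ω).val) : ℝ) ∂P)
      atTop (𝓝 B)) :
    Tendsto (fun m : ℕ => ((m * q : ℕ) : ℝ) *
      P.real {ω | ScanJump (m * q) (m * p) k (occ (2 * (m * q)) (X ω).val)}) atTop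
      (𝓝 (lam / 4 * (A + B))) := by
  have hq : 0 < q := hp.trans hpq
  have hn : Tendsto (fun m : ℕ => ((m * q : ℕ) : ℝ)) atTop atTop :=
    tendsto_natCast_atTop_atTop.comp (tendsto_id.atTop_mul_const' hq)
  set ρ : ℕ → ℝ := fun m => 1 - Real.exp (-(lam / 2 / (m * q : ℕ))) with hρdef
  have hnρ : Tendsto (fun m : ℕ => ((m * q : ℕ) : ℝ) * ρ m) atTop (𝓝 (lam / 2)) :=
    (tendsto_mul_one_sub_exp (lam / 2)).comp hn
  have hρ0 : Tendsto ρ atTop (𝓝 0) := by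
    have h := hnρ.mul (tendsto_inv_atTop_zero.comp hn)
    rw [mul_zero] at h
    refine h.congr' ((eventually_gt_atTop 0).mono fun m hm => ?_)
    have : ((m * q : ℕ) : ℝ) ≠ 0 := by positivity
    simp only [Function.comp]
    field_simp
  have hmain : Tendsto (fun m : ℕ =>
      ((m * q : ℕ) : ℝ) * ρ m * ((1 - ρ m) ^ 2 / (2 - ρ m)) *
          ∫ ω, (pairCount (m * q) (m * p) k (occ (m * q) (X ω).val) : ℝ) ∂P +
        ((m * q : ℕ) : ℝ) * ρ m * (1 / (2 - ρ m)) *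
          ∫ ω, (doubleCount (m * q) (m * p) k (occ (m * q) (X ω).val) : ℝ) ∂P) atTop
      (𝓝 (lam / 4 * (A + B))) := by
    have h2 : Tendsto (fun m => 2 - ρ m) atTop (𝓝 (2 - 0)) := hρ0.const_sub 2
    have h := ((hnρ.mul (((hρ0.const_sub 1).pow 2).div h2 (by norm_num))).mul hA).add
      ((hnρ.mul ((tendsto_const_nhds (x := (1 : ℝ))).div h2 (by norm_num))).mul hB)
    have he : lam / 4 * (A + B) = lam / 2 * ((1 - 0) ^ 2 / (2 - 0)) * A +
        lam / 2 * (1 / (2 - 0)) * B := by ring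
    rw [he]
    exact h
  have herr : Tendsto (fun m : ℕ => 72 * (((m * q : ℕ) : ℝ) * ρ m) ^ 2 * ρ m +
      36 * (((m * q : ℕ) : ℝ) * ρ m) ^ 3 * ρ m) atTop (𝓝 0) := by
    have h := (((hnρ.pow 2).const_mul 72).mul hρ0).add (((hnρ.pow 3).const_mul 36).mul hρ0)
    simpa using h
  rw [← sub_zero (lam / 4 * (A + B))]
  have hsq := squeeze_zero_norm' (f := fun m : ℕ => ((m * q : ℕ) : ℝ) *
      P.real {ω | ScanJump (m * q) (m * p) k (occ (2 * (m * q)) (X ω).val)} - (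
      ((m * q : ℕ) : ℝ) * ρ m * ((1 - ρ m) ^ 2 / (2 - ρ m)) *
          ∫ ω, (pairCount (m * q) (m * p) k (occ (m * q) (X ω).val) : ℝ) ∂P +
        ((m * q : ℕ) : ℝ) * ρ m * (1 / (2 - ρ m)) *
          ∫ ω, (doubleCount (m * q) (m * p) k (occ (m * q) (X ω).val) : ℝ) ∂P)) (by
    filter_upwards [eventually_gt_atTop 0] with m hm
    have hN : 0 < m * q := by positivity
    have hρm : ∀ j < 2 * (m * q), P.real {ω | occ (2 * (m * q)) (X ω).val j = 1} = ρ m := by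
      intro j hj
      rw [hX.measureReal_occ_eq_one hlam hj, hρdef]
      congr 2
      push_cast
      field_simp
    have hρ1 : ρ m ≤ 1 := by
      have := Real.exp_pos (-(lam / 2 / (m * q : ℕ)))
      simp only [hρdef]
      linarith
    have h := abs_measureReal_scanJump_sub_le (k := k)
      (g := fun j ω => occ (2 * (m * q)) (X ω).val j)
      (fun j => hX.measurable_occ _ j) (hX.iIndepFun_occ (by positivity))
      (fun j ω => occ_le_one _ _ _) hρm (hρm 0 (by omega) ▸ measureReal_nonneg) hρ1
      (show 1 ≤ m * p by have : 0 < m * p := by positivity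
                         omega)
      (Nat.mul_le_mul_left m hpq.le) hk
    simp only [coarsen_occ hN] at h
    have h' := mul_le_mul_of_nonneg_left h (Nat.cast_nonneg (α := ℝ) (m * q))
    rw [← abs_of_nonneg (Nat.cast_nonneg (α := ℝ) (m * q)), ← abs_mul,
      abs_of_nonneg (Nat.cast_nonneg (α := ℝ) (m * q))] at h'
    rw [Real.norm_eq_abs]
    refine (le_of_eq ?_).trans (h'.trans (le_of_eq ?_))
    · congr 1
      ring
    · ring) herr
  have := hmain.add hsq
  rw [add_zero] at this
  rw [sub_zero]
  exact this.congr fun m => by ring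

end Poisson

end ScanStatistic

theorem theorem2p1 {Ω : Type*} [MeasurableSpace Ω] (P : Measure Ω) [IsProbabilityMeasure P]
    (lam : ℝ) (hlam : 0 < lam) (p q k : ℕ) (hp : 0 < p) (hpq : p < q) (hcop : Nat.Coprime p q)
    (hk : 2 ≤ k)
    (X : Ω → Finset ℝ) (hX : ScanStatistic.IsPoissonProcess P lam X)
    {Ω' : ℕ → Type*} [∀ m, MeasurableSpace (Ω' m)] (P' : ∀ m, Measure (Ω' m))
    [∀ m, IsProbabilityMeasure (P' m)]
    (I : ∀ m : ℕ, Fin (m * q) → Ω' m → ℕ)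
    (hI : ∀ m, ScanStatistic.IsBernoulliCells (P' m) lam (m * q) (I m)) :
    Integrable (fun ω => (ScanStatistic.nu k ((p : ℝ) / q) (X ω) : ℝ) +
        ScanStatistic.nuTilde k ((p : ℝ) / q) (X ω)) P ∧
    Tendsto (fun m : ℕ => ((m * q : ℕ) : ℝ) *
        (P.real {ω | k ≤ ScanStatistic.scan ((p : ℝ) / q) (X ω).val} -
          (P' m).real {ω | k ≤ ScanStatistic.discreteScan (m * q) (m * p) (fun i => I m i ω)}))
      atTop
      (𝓝 (lam / 2 * ∫ ω, ((ScanStatistic.nu k ((p : ℝ) / q) (X ω) : ℝ) +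
        ScanStatistic.nuTilde k ((p : ℝ) / q) (X ω)) ∂P)) := by
  open ScanStatistic in
  have hq : 0 < q := hp.trans hpq
  have hq' : (q : ℝ) ≠ 0 := by positivity
  have hk0 : 0 < k := by omega
  have hLn : ∀ m, m * p ≤ m * q := fun m => Nat.mul_le_mul_left m hpq.le
  obtain ⟨hν, hνlim⟩ := integrable_and_tendsto_integral hX
    (F := fun m ω => pairCount (m * q) (m * p) k (occ (m * q) (X ω).val))
    (fun m hm => measurable_pairCount_occ hX (by positivity) (hLn m) k)
    (fun m hm ω => pairCount_occ_le (by positivity) _ k _) (nu_le hX k ((p : ℝ) / q))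
    ((hX.ae_isGeneric hlam hp hpq).mono fun ω hω =>
      eventually_pairCount hp hpq k (hX.mem_Ioc ω) hω)
  obtain ⟨hν', hνlim'⟩ := integrable_and_tendsto_integral hX
    (F := fun m ω => doubleCount (m * q) (m * p) k (occ (m * q) (X ω).val))
    (fun m hm => measurable_doubleCount_occ hX (by positivity) (hLn m) k)
    (fun m hm ω => doubleCount_occ_le (by positivity) _ k _) (nuTilde_le hX k ((p : ℝ) / q))
    (Eventually.of_forall fun ω => eventually_doubleCount hp hpq k (hX.mem_Ioc ω))
  refine ⟨hν.add hν', ?_⟩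
  rw [integral_add hν hν']
  have hjump := hX.tendsto_mul_scanJump hlam hp hpq hk0 hνlim hνlim'
  set a : ℕ → ℝ := fun m => P.real {ω | k ≤ windowScan (m * q) (m * p) (occ (m * q) (X ω).val)}
    with ha
  have hdiff : ∀ m, 0 < m → a (2 * m) - a m =
      P.real {ω | ScanJump (m * q) (m * p) k (occ (2 * (m * q)) (X ω).val)} := by
    intro m hm
    have hN : 0 < m * q := by positivity
    simp only [ha]
    rw [← measureReal_sdiff]
    · congr 1
      ext ω
      simp [ScanJump, coarsen_occ hN, mul_assoc]
    · intro ω hω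
      simp only [mem_ofPred_eq, mul_assoc] at hω ⊢
      rw [← coarsen_occ hN] at hω
      exact hω.trans (windowScan_coarsen_le _)
    · exact measurableSet_of_dependsOn (fun j => hX.measurable_occ (m * q) j)
        (le_windowScan_dependsOn (hLn m) k)
  have hdouble : Tendsto (fun m : ℕ => m * (a (2 * m) - a m)) atTop
      (𝓝 (lam / 4 * (∫ ω, (nu k ((p : ℝ) / q) (X ω) : ℝ) ∂P +
        ∫ ω, (nuTilde k ((p : ℝ) / q) (X ω) : ℝ) ∂P) / q)) := by
    refine (hjump.div_const (q : ℝ)).congr' ((eventually_gt_atTop 0).mono fun m hm => ?_)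
    simp only [hdiff m hm]
    push_cast
    field_simp
  have h := (tendsto_mul_sub_of_doubling (tendsto_measureReal_windowScan hX hp hpq k)
    hdouble).const_mul (q : ℝ)
  convert h.congr' ((eventually_gt_atTop 0).mono fun m hm => ?_) using 2
  · field_simp
    ring
  · rw [(hI m).measureReal_discreteScan hX hlam (by positivity) (hLn m)]
    push_cast
    ring
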